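/- Let $K$ be a field of characteristic $0$ and let $q\in K$ satisfy $q^n\neq 1$ for all $n\ge 1$ (for example $K=\mathbb{Q}(q)$ with $q$ an indeterminate). Let $\Lambda$ be the ring of symmetric functions over $K$ in the variables $x_1,x_2,\dots$ and let $\hat\Lambda$ be its completion with respect to degree, that is, the ring of all symmetric formal power series in $x_1,x_2,\dots$; every element of $\hat\Lambda$ is uniquely a formal power series in the power sums $p_n=\sum_i x_i^n$, $n\ge 1$. Let $\omega_q=\omega_{q,0}:\hat\Lambda\to\hat\Lambda$ be the continuous $K$-algebra homomorphism with $$\omega_q(p_n)=(-1)^{n-1}(1-q^n)\,p_n ,\qquad n\ge 1,$$ where in general $\omega_{q,t}(p_n)=(-1)^{n-1}\frac{1-q^n}{1-t^n}\,p_n$. For partitions $\lambda,\mu$ write $\mu\prec\lambda$ if $\mu\subseteq\lambda$ and $\lambda/\mu$ has at most one box in each column; write $\lambda'$ for the conjugate of $\lambda$, $m_i(\lambda)$ for the number of parts of $\lambda$ equal to $i$, $\ell(\lambda)$ for the number of parts, and $(a;q)_k=\prod_{i=0}^{k-1}(1-aq^i)$. The skew inhomogeneous $q$-Whittaker polynomials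 are defined in one variable by $$F_{\lambda/\mu}(x)=\mathbf 1_{\mu\prec\lambda}\;x^{|\lambda|-|\mu|}\prod_{r=1}^{\ell(\lambda)}(x;q)_{\mu_r-\lambda_{r+1}}\frac{(q;q)_{\lambda_r-\lambda_{r+1}}}{(q;q)_{\lambda_r-\mu_r}\,(q;q)_{\mu_r-\lambda_{r+1}}} .$$ The dual skew inhomogeneous Hall–Littlewood functions are defined in one variable by $$J_{\lambda/\mu}(x;t)=\mathbf 1_{\mu\prec\lambda}\;\kappa_{\lambda/\mu}\left(\frac1{1+x}\right)^{r(\mu/\tilde\lambda)}\left(\frac{x}{1+x}\right)^{|\lambda|-|\mu|}\prod_{i\in E_{\lambda/\mu}}\bigl(1+x\,t^{m_i(\lambda)}\bigr),$$ expanded as a power series in $x$, where $\kappa_{\lambda/\mu}=\prod_{i\ge 1:\,m_i(\lambda)=m_i(\mu)+1}(1-t^{m_i(\lambda)})$, $\tilde\lambda=(\lambda_2,\lambda_3,\dots)$, $r(\mu/\tilde\lambda)$ is the number of nonempty rows of $\mu/\tilde\lambda$, and $E_{\lambda/\mu}$ is the set of $i\ge1$ such that the $i$-th and $(i+1)$-st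 columns of $\lambda/\mu$ are empty and $m_i(\lambda)\ne0$. For both families $f\in\{F,J\}$ the functions of $n$ variables are defined by $$f_{\lambda/\mu}(x_1,\dots,x_n)=\sum_{\mu\subseteq\nu\prec\lambda}f_{\nu/\mu}(x_1,\dots,x_{n-1})\,f_{\lambda/\nu}(x_n),$$ and, since $f_{\lambda/\mu}(x_1,\dots,x_n,0)=f_{\lambda/\mu}(x_1,\dots,x_n)$, they define formal power series $f_{\lambda/\mu}(x_1,x_2,\dots)$ in countably many variables. Proposition. For all partitions $\lambda,\mu$, the series $F_{\lambda/\mu}=F_{\lambda/\mu}(x_1,x_2,\dots)$ and $J_{\lambda'/\mu'}=J_{\lambda'/\mu'}(x_1,x_2,\dots;q)$ belong to $\hat\Lambda$, and $$\omega_q\bigl(F_{\lambda/\mu}\bigr)=J_{\lambda'/\mu'} .$$ -/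

import Mathlib

namespace InhomWhittaker

noncomputable section

open Finset

/-- The ring of symmetric formal power series in the variables `X 0, X 1, …`: power series (of
possibly unbounded degree) that are fixed by every permutation of the variables. This is the
completion, with respect to the degree, of the ring of symmetric functions. -/
def SymSeries (K : Type*) [Field K] : Subalgebra K (MvPowerSeries ℕ K) where
  carrier := {f | ∀ σ : Equiv.Perm ℕ, MvPowerSeries.renameEquiv K σ f = f}
  mul_mem' {f g} hf hg σ := by rw [map_mul, hf σ, hg σ]
  add_mem' {f g} hf hg σ := by rw [map_add, hf σ, hg σ]
  algebraMap_mem' r σ := by rw [AlgEquiv.commutes]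

section PowerSums

variable {K : Type*} [Field K]

open Classical in
/-- The power sum `p_n = ∑ i, (X i) ^ n`, for `n ≥ 1`. -/
def pSum (K : Type*) [Field K] (n : ℕ+) : MvPowerSeries ℕ K :=
  fun m => if ∃ i, m = Finsupp.single i (n : ℕ) then 1 else 0

open Classical in
theorem coeff_pSum (n : ℕ+) (m : ℕ →₀ ℕ) :
    MvPowerSeries.coeff m (pSum K n) = if ∃ i, m = Finsupp.single i (n : ℕ) then 1 else 0 := rfl

theorem hasSubst_pSum : MvPowerSeries.HasSubst (pSum K) where
  const_coeff s := by
    have : MvPowerSeries.constantCoeff (pSum K s) = 0 := by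
      rw [← MvPowerSeries.coeff_zero_eq_constantCoeff_apply, coeff_pSum, if_neg]
      rintro ⟨i, hi⟩
      have := DFunLike.congr_fun hi i
      simp only [Finsupp.coe_zero, Pi.zero_apply, Finsupp.single_eq_same] at this
      exact s.pos.ne this
    rw [this]; exact IsNilpotent.zero
  coeff_zero d := by
    refine Set.Subsingleton.finite ?_
    intro s hs t ht
    simp only [coeff_pSum, Set.mem_ofPred_eq, ne_eq, ite_eq_right_iff, one_ne_zero, imp_false,
      not_not] at hs ht
    obtain ⟨i, hi⟩ := hs
    obtain ⟨j, hj⟩ := ht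
    have := congrArg Finsupp.degree (hi.symm.trans hj)
    simpa using this

/-- The monomial `∏ n, p_n ^ (d n)` in the power sums. -/
def pMon (K : Type*) [Field K] (d : ℕ+ →₀ ℕ) : MvPowerSeries ℕ K :=
  d.prod fun s e => pSum K s ^ e

theorem pMon_add_single (d : ℕ+ →₀ ℕ) (s : ℕ+) :
    pMon K (d + Finsupp.single s 1) = pMon K d * pSum K s := by
  unfold pMon
  rw [Finsupp.prod_add_index' (by simp) (by intros; rw [pow_add])]
  simp

theorem coeff_mul_pSum (g : MvPowerSeries ℕ K) (s : ℕ+) (m : ℕ →₀ ℕ) :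
    MvPowerSeries.coeff m (g * pSum K s) =
      ∑ i ∈ m.support with (s : ℕ) ≤ m i,
        MvPowerSeries.coeff (m - Finsupp.single i (s : ℕ)) g := by
  classical
  rw [MvPowerSeries.coeff_mul]
  simp only [coeff_pSum, mul_ite, mul_one, mul_zero]
  rw [← Finset.sum_filter]
  symm
  have hle : ∀ i, (s : ℕ) ≤ m i → Finsupp.single i (s : ℕ) ≤ m := by
    intro i hi; simpa using hi
  refine Finset.sum_bij
    (fun i _ => (m - Finsupp.single i (s : ℕ), Finsupp.single i (s : ℕ))) ?_ ?_ ?_ ?_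
  · intro i hi
    simp only [Finset.mem_filter] at hi
    simp only [Finset.mem_filter, Finset.HasAntidiagonal.mem_antidiagonal]
    exact ⟨tsub_add_cancel_of_le (hle i hi.2), i, rfl⟩
  · intro i hi j hj h
    have h2 := (Prod.mk.inj h).2
    rw [Finsupp.single_eq_single_iff] at h2
    rcases h2 with h2 | h2
    · exact h2.1
    · exact absurd h2.1 s.pos.ne'
  · rintro ⟨a, b⟩ hab
    simp only [Finset.mem_filter, Finset.HasAntidiagonal.mem_antidiagonal] at hab
    obtain ⟨hab, i, hi⟩ := hab
    subst hi
    have hs := s.pos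
    have hi : (s : ℕ) ≤ m i := by
      rw [← hab]; simp
    refine ⟨i, ?_, ?_⟩
    · simp only [Finset.mem_filter, Finsupp.mem_support_iff]
      exact ⟨by omega, hi⟩
    · rw [← hab]; simp
  · intro i hi
    rfl

/-- `m` has exactly `d s` exponents equal to `s`, for every `s ≥ 1`. -/
def HasShape (m : ℕ →₀ ℕ) (d : ℕ+ →₀ ℕ) : Prop :=
  ∀ s : ℕ+, #{i ∈ m.support | m i = (s : ℕ)} = d s

/-- The degree of `∏ n, p_n ^ (d n)`. -/
def wt (d : ℕ+ →₀ ℕ) : ℕ := d.sum fun s k => k * (s : ℕ)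

theorem wt_add_single (d : ℕ+ →₀ ℕ) (s : ℕ+) : wt (d + Finsupp.single s 1) = wt d + s := by
  unfold wt
  rw [Finsupp.sum_add_index' (by simp) (by intros; rw [add_mul])]
  simp

theorem finsupp_ind {P : (ℕ+ →₀ ℕ) → Prop} (h0 : P 0)
    (h1 : ∀ d s, P d → P (d + Finsupp.single s 1)) (d : ℕ+ →₀ ℕ) : P d := by
  induction d using Finsupp.induction with
  | zero => exact h0
  | single_add a b f _ _ ih =>
    clear * - ih h1
    induction b with
    | zero => simpa using ih
    | succ b hb =>
      have := h1 _ a hb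
      rwa [add_right_comm, ← Finsupp.single_add] at this

/-- Removing one exponent `s` that does not occur elsewhere. -/
theorem hasShape_add (m : ℕ →₀ ℕ) (i : ℕ) (s : ℕ+) (hi : m i = 0) (d : ℕ+ →₀ ℕ)
    : HasShape (m + Finsupp.single i (s : ℕ)) (d + Finsupp.single s 1) ↔ HasShape m d := by
  classical
  have hs := s.pos
  have hsupp : (m + Finsupp.single i (s : ℕ)).support = insert i m.support := by
    ext j
    by_cases hj : j = i
    · subst hj; simp
    · simp [hj]
  refine forall_congr' fun t => ?_
  have key : ({j ∈ (m + Finsupp.single i (s : ℕ)).support |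
      (m + Finsupp.single i (s : ℕ)) j = (t : ℕ)} : Finset ℕ) =
      if t = s then insert i {j ∈ m.support | m j = (t : ℕ)}
        else {j ∈ m.support | m j = (t : ℕ)} := by
    ext j
    by_cases hts : t = s
    · subst hts
      rw [if_pos rfl, Finset.mem_insert, Finset.mem_filter, Finset.mem_filter, hsupp]
      by_cases hj : j = i
      · subst hj; simp [hi]
      · simp [hj]
    · rw [if_neg hts, Finset.mem_filter, Finset.mem_filter, hsupp]
      have hst : ¬ (s : ℕ) = t := fun h => hts (PNat.coe_injective h).symm
      by_cases hj : j = i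
      · subst hj; simp [hi, hst]
      · simp [hj]
  rw [key]
  by_cases hts : t = s
  · subst hts
    rw [if_pos rfl, Finset.card_insert_of_notMem (by simp [hi])]
    simp
  · simp [hts]

theorem exists_hasShape (d : ℕ+ →₀ ℕ) : ∃ m, HasShape m d := by
  induction d using finsupp_ind with
  | h0 => exact ⟨0, fun s => by simp⟩
  | h1 d s ih =>
    obtain ⟨m, hm⟩ := ih
    obtain ⟨i, hi⟩ := Infinite.exists_notMem_finset m.support
    exact ⟨_, (hasShape_add m i s (by simpa using hi) d).2 hm⟩

theorem exists_shape (m : ℕ →₀ ℕ) : ∃ d, HasShape m d := by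
  classical
  refine ⟨Finsupp.ofSupportFinite (fun s : ℕ+ => #{i ∈ m.support | m i = (s : ℕ)}) ?_,
    fun s => rfl⟩
  refine (Set.Finite.preimage (f := ((↑) : ℕ+ → ℕ)) PNat.coe_injective.injOn
    (m.support.image m).finite_toSet).subset ?_
  intro s hs
  have : (#{i ∈ m.support | m i = (s : ℕ)}) ≠ 0 := hs
  rw [Finset.card_ne_zero] at this
  obtain ⟨i, hi⟩ := this
  simp only [Finset.mem_filter] at hi
  simp only [Set.mem_preimage, Finset.mem_coe, Finset.mem_image]
  exact ⟨i, hi⟩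

/-- Triangularity of the expansion of power sum products in monomials. -/
theorem coeff_pMon (d : ℕ+ →₀ ℕ) (m : ℕ →₀ ℕ) :
    ∃ r : ℕ, MvPowerSeries.coeff m (pMon K d) = r ∧
      (r ≠ 0 → m.degree = wt d ∧ #m.support ≤ d.degree ∧
        (#m.support = d.degree → HasShape m d)) ∧ (HasShape m d → r ≠ 0 ∧ #m.support = d.degree) := by
  classical
  induction d using finsupp_ind generalizing m with
  | h0 =>
    refine ⟨if m = 0 then 1 else 0, ?_, ?_, ?_⟩
    · simp [pMon, MvPowerSeries.coeff_one]
    · intro h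
      have hm : m = 0 := by by_contra hm; simp [hm] at h
      subst hm
      simp [wt, HasShape]
    · intro h
      have hm : m = 0 := by
        ext i
        by_contra hi
        have hi' : m i ≠ 0 := hi
        obtain ⟨s, hs⟩ : ∃ s : ℕ+, (s : ℕ) = m i := ⟨⟨m i, Nat.pos_of_ne_zero hi'⟩, rfl⟩
        have := h s
        rw [Finsupp.coe_zero, Pi.zero_apply, Finset.card_eq_zero] at this
        have h2 : i ∈ ({j ∈ m.support | m j = (s : ℕ)} : Finset ℕ) := by simp [hi', hs]
        rw [this] at h2
        simp at h2
      simp [hm]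
  | h1 d s ih =>
    choose r hr1 hr2 hr3 using ih
    have hs := s.pos
    refine ⟨∑ i ∈ m.support with (s : ℕ) ≤ m i, r (m - Finsupp.single i (s : ℕ)), ?_, ?_, ?_⟩
    · rw [pMon_add_single, coeff_mul_pSum]
      push_cast
      exact Finset.sum_congr rfl fun i _ => hr1 _
    · intro h
      obtain ⟨i, hi, hri⟩ := Finset.exists_ne_zero_of_sum_ne_zero h
      simp only [Finset.mem_filter, Finsupp.mem_support_iff] at hi
      obtain ⟨h1, h2, h3⟩ := hr2 _ hri
      set m' := m - Finsupp.single i (s : ℕ) with hm'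
      have hmm : m = m' + Finsupp.single i (s : ℕ) :=
        (tsub_add_cancel_of_le (by simpa using hi.2)).symm
      have hsub : m.support ⊆ insert i m'.support := by
        intro j hj
        by_cases hji : j = i
        · simp [hji]
        · simp only [Finset.mem_insert, hji, Finsupp.mem_support_iff, false_or]
          rw [hmm] at hj
          simpa [Finsupp.single_apply, Ne.symm hji] using hj
      have hcard := (Finset.card_le_card hsub).trans (Finset.card_insert_le _ _)
      refine ⟨?_, ?_, ?_⟩
      · rw [hmm, wt_add_single, ← h1]; simp
      · simp only [map_add, Finsupp.degree_single]; omega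
      · intro he
        simp only [map_add, Finsupp.degree_single] at he
        have h4 : m' i = 0 := by
          by_contra h4
          have : insert i m'.support = m'.support :=
            Finset.insert_eq_of_mem (by simpa using h4)
          rw [this] at hsub
          have := Finset.card_le_card hsub
          omega
        rw [hmm, hasShape_add _ _ _ h4]
        apply h3
        omega
    · intro h
      have h1 := h s
      have h2 : ({i ∈ m.support | m i = (s : ℕ)} : Finset ℕ).Nonempty := by
        rw [← Finset.card_pos, h1]; simp
      obtain ⟨i, hi⟩ := h2
      simp only [Finset.mem_filter, Finsupp.mem_support_iff] at hi
      have hmem : i ∈ ({i ∈ m.support | (s : ℕ) ≤ m i} : Finset ℕ) := by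
        simp [hi.2]
      set m' := m - Finsupp.single i (s : ℕ) with hm'
      have hmm : m = m' + Finsupp.single i (s : ℕ) :=
        (tsub_add_cancel_of_le (by simp [hi.2])).symm
      have h4 : m' i = 0 := by simp [hm', hi.2]
      rw [hmm, hasShape_add _ _ _ h4] at h
      obtain ⟨h5, h6⟩ := hr3 m' h
      refine ⟨?_, ?_⟩
      · intro h0
        rw [Finset.sum_eq_zero_iff] at h0
        exact h5 (h0 i hmem)
      · have hsupp : m.support = insert i m'.support := by
          rw [hmm]
          ext j
          by_cases hj : j = i
          · subst hj; simp
          · simp [hj]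
        rw [hsupp, Finset.card_insert_of_notMem (by simpa using h4), h6]
        simp

theorem hasShape_unique {m : ℕ →₀ ℕ} {d d' : ℕ+ →₀ ℕ} (h : HasShape m d) (h' : HasShape m d') :
    d = d' := by
  ext s
  rw [← h s, ← h' s]

theorem hasShape_degree {m : ℕ →₀ ℕ} {d : ℕ+ →₀ ℕ} (h : HasShape m d) : m.degree = wt d := by
  obtain ⟨r, -, h2, h3⟩ := coeff_pMon (K := ℚ) d m
  exact (h2 (h3 h).1).1

theorem finite_wt (w : ℕ) : {d : ℕ+ →₀ ℕ | wt d = w}.Finite := by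
  classical
  let b : ℕ+ →₀ ℕ := Finsupp.ofSupportFinite (fun s => if (s : ℕ) ≤ w then w else 0) (by
    refine ((Set.finite_Iic w).preimage (f := ((↑) : ℕ+ → ℕ)) PNat.coe_injective.injOn).subset ?_
    intro s hs
    have : (if (s : ℕ) ≤ w then w else 0) ≠ 0 := hs
    simp only [Set.mem_preimage, Set.mem_Iic]
    by_contra hc
    simp [hc] at this)
  refine (Set.finite_Iic b).subset ?_
  intro d hd
  have hd : d.sum (fun s k => k * (s : ℕ)) = w := hd
  simp only [Set.mem_Iic]
  intro s
  change d s ≤ if (s : ℕ) ≤ w then w else 0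
  by_cases h0 : d s = 0
  · simp [h0]
  have h1 : d s * (s : ℕ) ≤ w := by
    rw [← hd]
    exact Finset.single_le_sum (f := fun s => d s * (s : ℕ)) (fun _ _ => Nat.zero_le _)
      (by simpa using h0)
  have hs := s.pos
  have h2 : d s ≤ w := le_trans (Nat.le_mul_of_pos_right _ hs) h1
  have h3 : (s : ℕ) ≤ w := le_trans (Nat.le_mul_of_pos_left _ (Nat.pos_of_ne_zero h0)) h1
  simp [h2, h3]

theorem exists_perm {m m' : ℕ →₀ ℕ} {d : ℕ+ →₀ ℕ} (h : HasShape m d) (h' : HasShape m' d) :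
    ∃ σ : Equiv.Perm ℕ, ∀ i, m' (σ i) = m i := by
  have key : ∀ c : ℕ, Nonempty ({i // m i = c} ≃ {i // m' i = c}) := by
    intro c
    rcases Nat.eq_zero_or_pos c with rfl | hc
    · have inf : ∀ m : ℕ →₀ ℕ, Infinite {i // m i = 0} := by
        intro m
        have : {i | m i = 0}.Infinite := by
          have := m.support.finite_toSet.infinite_compl
          refine this.mono ?_
          intro i hi
          simpa using hi
        exact this.to_subtype
      have := inf m
      have := inf m'
      exact nonempty_equiv_of_countable
    · have e : ∀ (m : ℕ →₀ ℕ) (i : ℕ),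
          i ∈ ({i ∈ m.support | m i = ((⟨c, hc⟩ : ℕ+) : ℕ)} : Finset ℕ) ↔ m i = c := by
        intro m i
        rw [Finset.mem_filter]
        simp only [Finsupp.mem_support_iff]
        constructor
        · exact fun h => h.2
        · exact fun h => ⟨by omega, h⟩
      have hcard := (h ⟨c, hc⟩).trans (h' ⟨c, hc⟩).symm
      exact ⟨(Equiv.subtypeEquivRight (fun i => (e m i).symm)).trans
        ((Finset.equivOfCardEq hcard).trans (Equiv.subtypeEquivRight (fun i => e m' i)))⟩
  have e := fun c => (key c).some
  exact ⟨Equiv.ofFiberEquiv (f := m) (g := m') e, fun i => Equiv.ofFiberEquiv_map e i⟩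

theorem mem_symSeries_iff (f : MvPowerSeries ℕ K) :
    f ∈ SymSeries K ↔ ∀ (σ : Equiv.Perm ℕ) (m m' : ℕ →₀ ℕ), (∀ i, m' (σ i) = m i) →
      MvPowerSeries.coeff m' f = MvPowerSeries.coeff m f := by
  have key : ∀ (σ : Equiv.Perm ℕ) (m : ℕ →₀ ℕ),
      MvPowerSeries.coeff (m.embDomain σ.toEmbedding) (MvPowerSeries.renameEquiv K σ f) =
        MvPowerSeries.coeff m f := fun σ m =>
    MvPowerSeries.coeff_embDomain_rename σ.toEmbedding f m
  constructor
  · intro hf σ m m' h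
    have hm : m' = m.embDomain σ.toEmbedding := by
      ext j
      obtain ⟨i, rfl⟩ := σ.surjective j
      rw [h]
      exact (Finsupp.embDomain_apply_self σ.toEmbedding m i).symm
    rw [← key σ m, hf σ, hm]
  · intro h σ
    ext m'
    set m := m'.embDomain σ.symm.toEmbedding with hm
    have h1 : ∀ i, m' (σ i) = m i := by
      intro i
      have := Finsupp.embDomain_apply_self σ.symm.toEmbedding m' (σ i)
      rw [← this, hm]
      simp
    have hm : m' = m.embDomain σ.toEmbedding := by
      ext j
      obtain ⟨i, rfl⟩ := σ.surjective j
      rw [h1]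
      exact (Finsupp.embDomain_apply_self σ.toEmbedding m i).symm
    rw [h σ m m' h1, ← key σ m, ← hm]

theorem pSum_mem (n : ℕ+) : pSum K n ∈ SymSeries K := by
  rw [mem_symSeries_iff]
  intro σ m m' h
  rw [coeff_pSum, coeff_pSum]
  congr 1
  apply propext
  constructor
  · rintro ⟨i, rfl⟩
    refine ⟨σ.symm i, ?_⟩
    ext j
    rw [← h j]
    simp [Finsupp.single_apply, Equiv.symm_apply_eq]
  · rintro ⟨i, rfl⟩
    refine ⟨σ i, ?_⟩
    ext j
    obtain ⟨k, rfl⟩ := σ.surjective j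
    rw [h k]
    simp [Finsupp.single_apply]

theorem pMon_mem (d : ℕ+ →₀ ℕ) : pMon K d ∈ SymSeries K :=
  Subalgebra.prod_mem _ fun s _ => Subalgebra.pow_mem _ (pSum_mem s) _

theorem coeff_subst_pSum (f : MvPowerSeries ℕ+ K) (m : ℕ →₀ ℕ) :
    MvPowerSeries.coeff m (MvPowerSeries.subst (pSum K) f) =
      ∑ᶠ d, MvPowerSeries.coeff d f * MvPowerSeries.coeff m (pMon K d) := by
  rw [MvPowerSeries.coeff_subst hasSubst_pSum]
  rfl

/-- Evaluation of a formal power series in indeterminates `P_1, P_2, …` at the power sums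
`p_1, p_2, …`; the result is a symmetric series. -/
def pEval (K : Type*) [Field K] : MvPowerSeries ℕ+ K →ₐ[K] SymSeries K :=
  (MvPowerSeries.substAlgHom hasSubst_pSum).codRestrict (SymSeries K) (by
    intro f
    rw [MvPowerSeries.coe_substAlgHom, mem_symSeries_iff]
    intro σ m m' h
    rw [coeff_subst_pSum, coeff_subst_pSum]
    refine finsum_congr fun d => ?_
    rw [(mem_symSeries_iff _).1 (pMon_mem d) σ m m' h])

theorem coeff_pEval (f : MvPowerSeries ℕ+ K) (m : ℕ →₀ ℕ) :
    MvPowerSeries.coeff m (pEval K f : MvPowerSeries ℕ K) =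
      ∑ᶠ d, MvPowerSeries.coeff d f * MvPowerSeries.coeff m (pMon K d) := by
  rw [← coeff_subst_pSum, ← MvPowerSeries.coe_substAlgHom hasSubst_pSum]
  rfl

variable [CharZero K]

theorem coeff_pMon_eq_zero {d : ℕ+ →₀ ℕ} {m : ℕ →₀ ℕ} (h : wt d ≠ m.degree) :
    MvPowerSeries.coeff m (pMon K d) = 0 := by
  obtain ⟨r, h1, h2, -⟩ := coeff_pMon (K := K) d m
  rw [h1]
  by_contra hr
  exact h (h2 (by rintro rfl; simp at hr)).1.symm

theorem pEval_ne_zero {f : MvPowerSeries ℕ+ K} (hf : f ≠ 0) :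
    ∃ d, MvPowerSeries.coeff d f ≠ 0 ∧ ∀ m, HasShape m d →
      MvPowerSeries.coeff m (pEval K f : MvPowerSeries ℕ K) ≠ 0 := by
  obtain ⟨d₀, hd₀⟩ : ∃ d, MvPowerSeries.coeff d f ≠ 0 := by
    by_contra! h
    exact hf (MvPowerSeries.ext h)
  obtain ⟨d, ⟨hd1, hd2⟩, hmax⟩ := Set.exists_max_image
    {d | wt d = wt d₀ ∧ MvPowerSeries.coeff d f ≠ 0} Finsupp.degree
    ((finite_wt (wt d₀)).subset fun d hd => hd.1) ⟨d₀, rfl, hd₀⟩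
  refine ⟨d, hd2, fun m hm => ?_⟩
  rw [coeff_pEval, finsum_eq_single _ d]
  · obtain ⟨r, h1, -, h3⟩ := coeff_pMon (K := K) d m
    rw [h1]
    exact mul_ne_zero hd2 (Nat.cast_ne_zero.2 (h3 hm).1)
  · intro d' hne
    by_contra hc
    obtain ⟨hc1, hc2⟩ := mul_ne_zero_iff.1 hc
    obtain ⟨r, h1, h2, -⟩ := coeff_pMon (K := K) d' m
    obtain ⟨h4, h5, h6⟩ := h2 (by rintro rfl; exact hc2 (by simp [h1]))
    have h7 : d'.degree ≤ d.degree := hmax d' ⟨by rw [← h4, hasShape_degree hm, hd1], hc1⟩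
    obtain ⟨r, -, -, h3⟩ := coeff_pMon (K := K) d m
    have h8 := (h3 hm).2
    exact hne (hasShape_unique (h6 (by omega)) hm)

theorem pEval_injective : Function.Injective (pEval K) := by
  rw [injective_iff_map_eq_zero]
  intro f hf
  by_contra h
  obtain ⟨d, -, h2⟩ := pEval_ne_zero h
  obtain ⟨m, hm⟩ := exists_hasShape d
  exact h2 m hm (by rw [hf]; simp)

theorem pEval_surjective : Function.Surjective (pEval K) := by
  classical
  intro g
  choose mm hmm using exists_hasShape
  -- extension by zero of a coefficient vector in a fixed degree
  let ext : ∀ w : ℕ, ({d : ℕ+ →₀ ℕ | wt d = w} → K) →ₗ[K] MvPowerSeries ℕ+ K := fun w =>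
    { toFun := fun c d => if h : wt d = w then c ⟨d, h⟩ else 0
      map_add' := by
        intro c c'
        funext d
        change _ = (if h : wt d = w then c ⟨d, h⟩ else 0) +
          (if h : wt d = w then c' ⟨d, h⟩ else 0)
        by_cases h : wt d = w <;> simp [h]
      map_smul' := by
        intro a c
        funext d
        change _ = a * (if h : wt d = w then c ⟨d, h⟩ else 0)
        by_cases h : wt d = w <;> simp [h] }
  have hext : ∀ w c d, MvPowerSeries.coeff d (ext w c) =
      if h : wt d = w then c ⟨d, h⟩ else 0 := fun w c d => rfl
  let T : ∀ w : ℕ, ({d : ℕ+ →₀ ℕ | wt d = w} → K) →ₗ[K] ({d : ℕ+ →₀ ℕ | wt d = w} → K) :=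
    fun w => LinearMap.pi fun d => (MvPowerSeries.coeff (mm d.1)).comp
      ((SymSeries K).val.toLinearMap.comp ((pEval K).toLinearMap.comp (ext w)))
  have hT : ∀ w c d, T w c d =
      MvPowerSeries.coeff (mm d.1) (pEval K (ext w c) : MvPowerSeries ℕ K) := fun w c d => rfl
  have hsurj : ∀ w, Function.Surjective (T w) := by
    intro w
    have : Finite {d : ℕ+ →₀ ℕ | wt d = w} := finite_wt w
    rw [← LinearMap.injective_iff_surjective, injective_iff_map_eq_zero]
    intro c hc
    by_contra hne
    have hne' : ext w c ≠ 0 := by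
      intro h0
      apply hne
      funext d
      have h1 := hext w c d.1
      have h2 : wt d.1 = w := d.2
      rw [h0, dif_pos h2] at h1
      simpa using h1.symm
    obtain ⟨d, h1, h2⟩ := pEval_ne_zero hne'
    have h3 : wt d = w := by
      by_contra h3
      exact h1 (by rw [hext, dif_neg h3])
    exact h2 (mm d) (hmm d) (by rw [← hT w c ⟨d, h3⟩, hc]; rfl)
  choose c hc using fun w => hsurj w (fun d => MvPowerSeries.coeff (mm d.1) (g : MvPowerSeries ℕ K))
  let f : MvPowerSeries ℕ+ K := fun d => c (wt d) ⟨d, rfl⟩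
  have hf : ∀ d, MvPowerSeries.coeff d f = c (wt d) ⟨d, rfl⟩ := fun d => rfl
  have hfm : ∀ m, MvPowerSeries.coeff m (pEval K f : MvPowerSeries ℕ K) =
      MvPowerSeries.coeff m (pEval K (ext m.degree (c m.degree)) : MvPowerSeries ℕ K) := by
    intro m
    rw [coeff_pEval, coeff_pEval]
    refine finsum_congr fun d => ?_
    by_cases h : wt d = m.degree
    · congr 1
      rw [hf, hext, dif_pos h]
      generalize m.degree = w at h
      subst h
      rfl
    · rw [coeff_pMon_eq_zero h, mul_zero, mul_zero]
  refine ⟨f, Subtype.ext (MvPowerSeries.ext fun m => ?_)⟩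
  obtain ⟨d, hd⟩ := exists_shape m
  obtain ⟨σ, hσ⟩ := exists_perm hd (hmm d)
  rw [← (mem_symSeries_iff _).1 (pEval K f).2 σ m (mm d) hσ,
    ← (mem_symSeries_iff _).1 g.2 σ m (mm d) hσ, hfm]
  have h1 : wt d = (mm d).degree := (hasShape_degree (hmm d)).symm
  have h2 := congrFun (hc (mm d).degree) ⟨d, h1⟩
  rw [hT] at h2
  exact h2

variable (K) in
/-- The ring of symmetric series is the ring of all formal power series in the power sums
`p_1, p_2, …`. -/
def pEquiv : MvPowerSeries ℕ+ K ≃ₐ[K] SymSeries K :=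
  AlgEquiv.ofBijective (pEval K) ⟨pEval_injective, pEval_surjective⟩

/-- The homomorphism `ω_{q,t}` of the ring of symmetric series: the substitution
`p_n ↦ (-1)^(n-1) (1 - q^n) / (1 - t^n) p_n` in power series in the power sums. -/
def omega (q t : K) : SymSeries K →ₐ[K] SymSeries K :=
  ((pEquiv K).toAlgHom.comp (MvPowerSeries.rescaleAlgHom
    (fun n : ℕ+ => (-1) ^ ((n : ℕ) - 1) * ((1 - q ^ (n : ℕ)) / (1 - t ^ (n : ℕ)))))).comp
      (pEquiv K).symm.toAlgHom

theorem pEquiv_X (n : ℕ+) : pEquiv K (MvPowerSeries.X n) = ⟨pSum K n, pSum_mem n⟩ :=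
  Subtype.ext (MvPowerSeries.substAlgHom_X hasSubst_pSum n)

theorem omega_pSum (q t : K) (n : ℕ+) :
    omega q t ⟨pSum K n, pSum_mem n⟩ =
      ((-1) ^ ((n : ℕ) - 1) * ((1 - q ^ (n : ℕ)) / (1 - t ^ (n : ℕ)))) •
        ⟨pSum K n, pSum_mem n⟩ := by
  classical
  rw [← pEquiv_X, ← map_smul]
  simp only [omega, AlgHom.comp_apply, AlgEquiv.toAlgHom_apply, AlgEquiv.symm_apply_apply]
  congr 1
  ext d
  rw [MvPowerSeries.rescaleAlgHom_apply, MvPowerSeries.coeff_rescale, MvPowerSeries.coeff_smul,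
    MvPowerSeries.coeff_X]
  split_ifs with h
  · subst h; simp
  · simp

end PowerSums

section Partitions

/-- `lam / mu` is a horizontal strip: `mu ⊆ lam`, with at most one box of the difference in each
column. -/
def IsHorizontalStrip (mu lam : YoungDiagram) : Prop :=
  mu ≤ lam ∧ ∀ j, lam.colLen j ≤ mu.colLen j + 1

theorem finite_le (lam : YoungDiagram) : {nu : YoungDiagram | nu ≤ lam}.Finite := by
  refine Set.Finite.of_finite_image (f := YoungDiagram.cells)
    ((lam.cells.powerset.finite_toSet).subset ?_) ?_
  · rintro _ ⟨nu, hnu, rfl⟩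
    simpa using YoungDiagram.cells_subset_iff.2 hnu
  · intro a _ b _ h
    exact YoungDiagram.ext h

theorem finite_between (mu lam : YoungDiagram) :
    {nu : YoungDiagram | mu ≤ nu ∧ IsHorizontalStrip nu lam}.Finite :=
  (finite_le lam).subset fun _ h => h.2.1

/-- The partitions `nu` with `mu ⊆ nu ≺ lam`. -/
def between (mu lam : YoungDiagram) : Finset YoungDiagram :=
  (finite_between mu lam).toFinset

/-- The multiplicity of the part `i` in the partition `lam`, for `i ≥ 1`. -/
def mult (lam : YoungDiagram) (i : ℕ) : ℕ :=
  #{r ∈ range (lam.colLen 0) | lam.rowLen r = i}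

/-- The `q`-Pochhammer symbol `(a; q)_k`. -/
def qPoch {A : Type*} [CommRing A] (a q : A) (k : ℕ) : A :=
  ∏ i ∈ range k, (1 - a * q ^ i)

end Partitions

section Functions

variable {K : Type*} [Field K]

/-- The `n`-variable skew function in `X 0, …, X (n - 1)` obtained from one-variable skew functions
by the branching rule
`f_{lam/mu}(x_1, …, x_n) = ∑ f_{nu/mu}(x_1, …, x_{n-1}) f_{lam/nu}(x_n)`, where `mu ⊆ nu ≺ lam`. -/
def branch (f : YoungDiagram → YoungDiagram → MvPowerSeries ℕ K → MvPowerSeries ℕ K)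
    (mu : YoungDiagram) : ℕ → YoungDiagram → MvPowerSeries ℕ K
  | 0, lam => open Classical in if lam = mu then 1 else 0
  | n + 1, lam => ∑ nu ∈ between mu lam, branch f mu n nu * f lam nu (MvPowerSeries.X n)

/-- The function in countably many variables defined by the stable sequence of the `n`-variable
functions `branch f mu n lam`: the coefficient of a monomial is read off from a number of variables
that contains all the variables of the monomial. -/
def branchLimit (f : YoungDiagram → YoungDiagram → MvPowerSeries ℕ K → MvPowerSeries ℕ K)
    (lam mu : YoungDiagram) : MvPowerSeries ℕ K :=
  fun m => MvPowerSeries.coeff m (branch f mu (m.support.sup (· + 1)) lam)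

/-- `f` reduces to the Kronecker delta at `x = 0`. -/
def IsDeltaAtZero (f : YoungDiagram → YoungDiagram → MvPowerSeries ℕ K → MvPowerSeries ℕ K) :
    Prop :=
  open Classical in ∀ lam mu x, x ∣ f lam mu x - (if lam = mu then 1 else 0)

theorem isHorizontalStrip_refl (lam : YoungDiagram) : IsHorizontalStrip lam lam :=
  ⟨le_rfl, fun _ => Nat.le_succ _⟩

/-- Stability: the coefficients of `branchLimit` agree with those of the `n`-variable functions
on all monomials in `X 0, …, X (n - 1)`. -/
theorem coeff_branchLimit {f : YoungDiagram → YoungDiagram → MvPowerSeries ℕ K → MvPowerSeries ℕ K}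
    (hf : IsDeltaAtZero f) (lam mu : YoungDiagram) (m : ℕ →₀ ℕ) (n : ℕ)
    (hn : ∀ i ∈ m.support, i < n) :
    MvPowerSeries.coeff m (branchLimit f lam mu) = MvPowerSeries.coeff m (branch f mu n lam) := by
  classical
  change MvPowerSeries.coeff m (branch f mu (m.support.sup (· + 1)) lam) = _
  have hle : m.support.sup (· + 1) ≤ n := Finset.sup_le fun i hi => hn i hi
  have hsup : ∀ i, m.support.sup (· + 1) ≤ i → m i = 0 := by
    intro i hi
    by_contra h
    have := Finset.le_sup (f := (· + 1)) (Finsupp.mem_support_iff.2 h)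
    omega
  induction n, hle using Nat.le_induction with
  | base => rfl
  | succ n hle ih =>
    have hmn := hsup n hle
    rw [ih fun i hi => lt_of_lt_of_le (Finset.le_sup (f := (· + 1)) hi) hle]
    rw [branch, map_sum]
    have key : ∀ nu, MvPowerSeries.coeff m (branch f mu n nu * f lam nu (MvPowerSeries.X n)) =
        if lam = nu then MvPowerSeries.coeff m (branch f mu n nu) else 0 := by
      intro nu
      obtain ⟨g, hg⟩ := hf lam nu (MvPowerSeries.X n)
      rw [sub_eq_iff_eq_add.1 hg, mul_add, map_add,
        MvPowerSeries.X_dvd_iff.1 (Dvd.intro (branch f mu n nu * g) (by ring)) m hmn, zero_add]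
      split_ifs <;> simp
    rw [Finset.sum_congr rfl fun nu _ => key nu, Finset.sum_ite_eq]
    split_ifs with h
    · rfl
    · have hnot : ¬ mu ≤ lam := fun h' => h (by
        simp only [between, Set.Finite.mem_toFinset]
        exact ⟨h', isHorizontalStrip_refl lam⟩)
      have hz : ∀ k, ∀ lam, ¬ mu ≤ lam → branch f mu k lam = 0 := by
        intro k
        cases k with
        | zero => intro lam h; rw [branch, if_neg]; rintro rfl; exact h le_rfl
        | succ k =>
          intro lam h
          rw [branch]
          refine Finset.sum_eq_zero fun nu hnu => ?_
          simp only [between, Set.Finite.mem_toFinset] at hnu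
          exact absurd (hnu.1.trans hnu.2.1) h
      rw [hz n lam hnot, map_zero]

open Classical in
/-- The one-variable skew inhomogeneous `q`-Whittaker polynomial. With rows numbered from `0`, the
factor of index `r` involves the row `r` of `lam` and `mu` and the row `r + 1` of `lam`. -/
def oneF (q : K) (lam mu : YoungDiagram) (x : MvPowerSeries ℕ K) : MvPowerSeries ℕ K :=
  if IsHorizontalStrip mu lam then
    x ^ (lam.card - mu.card) *
      ∏ r ∈ range (lam.colLen 0),
        (qPoch x (MvPowerSeries.C q) (mu.rowLen r - lam.rowLen (r + 1)) *
          MvPowerSeries.C (qPoch q q (lam.rowLen r - lam.rowLen (r + 1)) /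
            (qPoch q q (lam.rowLen r - mu.rowLen r) *
              qPoch q q (mu.rowLen r - lam.rowLen (r + 1)))))
  else 0

/-- The `n`-variable skew inhomogeneous `q`-Whittaker polynomial `F_{lam/mu}`. -/
def polyF (q : K) (n : ℕ) (lam mu : YoungDiagram) : MvPowerSeries ℕ K := branch (oneF q) mu n lam

/-- The skew inhomogeneous `q`-Whittaker function `F_{lam/mu}` in countably many variables. -/
def skewF (q : K) (lam mu : YoungDiagram) : MvPowerSeries ℕ K := branchLimit (oneF q) lam mu

/-- The coefficient `κ_{lam/mu}(t)`: the product of `1 - t ^ m_i(lam)` over the `i ≥ 1` with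
`m_i(lam) = m_i(mu) + 1`; such an `i` is a part of `lam`, hence at most `lam_1`. -/
def kappa (t : K) (lam mu : YoungDiagram) : K :=
  ∏ i ∈ Icc 1 (lam.rowLen 0) with mult lam i = mult mu i + 1, (1 - t ^ mult lam i)

/-- The number of nonempty rows of `mu / (lam_2, lam_3, …)`. -/
def rowsTail (lam mu : YoungDiagram) : ℕ :=
  #{r ∈ range (mu.colLen 0) | lam.rowLen (r + 1) < mu.rowLen r}

/-- The set of the `i ≥ 1` such that the `i`-th and `(i+1)`-st columns of `lam/mu` are empty and
`m_i(lam) ≠ 0`. The `i`-th column has the index `i - 1` in Mathlib, which counts from `0`. -/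
def setE (lam mu : YoungDiagram) : Finset ℕ :=
  {i ∈ Icc 1 (lam.rowLen 0) | lam.colLen (i - 1) = mu.colLen (i - 1) ∧
    lam.colLen i = mu.colLen i ∧ mult lam i ≠ 0}

open Classical in
/-- The one-variable dual skew inhomogeneous Hall–Littlewood function; the rational function is
expanded as a power series in `x`, which has constant term zero in every use. -/
def oneJ (t : K) (lam mu : YoungDiagram) (x : MvPowerSeries ℕ K) : MvPowerSeries ℕ K :=
  if IsHorizontalStrip mu lam then
    MvPowerSeries.C (kappa t lam mu) * (1 + x)⁻¹ ^ rowsTail lam mu *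
      (x * (1 + x)⁻¹) ^ (lam.card - mu.card) *
      ∏ i ∈ setE lam mu, (1 + x * MvPowerSeries.C (t ^ mult lam i))
  else 0

/-- The `n`-variable dual skew inhomogeneous Hall–Littlewood function `J_{lam/mu}`. -/
def polyJ (t : K) (n : ℕ) (lam mu : YoungDiagram) : MvPowerSeries ℕ K := branch (oneJ t) mu n lam

/-- The dual skew inhomogeneous Hall–Littlewood function `J_{lam/mu}` in countably many
variables. -/
def skewJ (t : K) (lam mu : YoungDiagram) : MvPowerSeries ℕ K := branchLimit (oneJ t) lam mu

theorem card_lt {lam mu : YoungDiagram} (h : mu ≤ lam) (hne : lam ≠ mu) : mu.card < lam.card :=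
  Finset.card_lt_card (YoungDiagram.cells_ssubset_iff.2 (lt_of_le_of_ne h (Ne.symm hne)))

theorem qPoch_ne_zero {q : K} (hq : ∀ n : ℕ, 1 ≤ n → q ^ n ≠ 1) (k : ℕ) : qPoch q q k ≠ 0 := by
  unfold qPoch
  rw [Finset.prod_ne_zero_iff]
  intro i _ h
  rw [← pow_succ'] at h
  exact hq (i + 1) (by omega) (sub_eq_zero.1 h).symm

theorem dvd_prod_sub_one {ι A : Type*} [CommRing A] (x : A) (s : Finset ι) (g : ι → A)
    (h : ∀ i ∈ s, x ∣ g i - 1) : x ∣ ∏ i ∈ s, g i - 1 := by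
  have : ∏ i ∈ s, g i ≡ ∏ _i ∈ s, 1 [SMOD Ideal.span {x}] := by
    rw [SModEq.sub_mem, ← Ideal.Quotient.eq, map_prod, map_prod]
    refine Finset.prod_congr rfl fun i hi => ?_
    rw [Ideal.Quotient.eq, Ideal.mem_span_singleton]
    exact h i hi
  rw [SModEq.sub_mem, Ideal.mem_span_singleton] at this
  simpa using this

theorem isDeltaAtZero_oneF {q : K} (hq : ∀ n : ℕ, 1 ≤ n → q ^ n ≠ 1) : IsDeltaAtZero (oneF q) := by
  classical
  intro lam mu x
  unfold oneF
  by_cases h : lam = mu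
  · subst h
    rw [if_pos (isHorizontalStrip_refl lam), if_pos rfl, Nat.sub_self, pow_zero, one_mul]
    refine dvd_prod_sub_one x _ _ fun r _ => ?_
    have h1 : ∀ k, qPoch q q k / (qPoch q q 0 * qPoch q q k) = 1 := by
      intro k
      have : qPoch q q 0 = 1 := by simp [qPoch]
      rw [this, one_mul, div_self (qPoch_ne_zero hq k)]
    rw [Nat.sub_self, h1, map_one, mul_one]
    refine dvd_prod_sub_one x _ _ fun i _ => ⟨-MvPowerSeries.C q ^ i, by ring⟩
  · rw [if_neg h, sub_zero]
    split_ifs with hs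
    · have := card_lt hs.1 h
      exact Dvd.dvd.mul_right (dvd_pow_self x (by omega)) _
    · exact dvd_zero x

theorem isDeltaAtZero_oneJ (t : K) : IsDeltaAtZero (oneJ t) := by
  classical
  intro lam mu x
  by_cases hx : MvPowerSeries.constantCoeff x = 0
  swap
  · exact (MvPowerSeries.isUnit_iff_constantCoeff.2 (isUnit_iff_ne_zero.2 hx)).dvd
  unfold oneJ
  by_cases h : lam = mu
  · subst h
    have h0 : kappa t lam lam = 1 := by
      refine Finset.prod_eq_one fun i hi => ?_
      simp only [Finset.mem_filter] at hi
      omega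
    have h1 : (1 + x) * (1 + x)⁻¹ = 1 := MvPowerSeries.mul_inv_cancel _ (by simp [hx])
    rw [if_pos (isHorizontalStrip_refl lam), if_pos rfl, Nat.sub_self, pow_zero, mul_one, h0,
      map_one, one_mul]
    have h2 : x ∣ (1 + x)⁻¹ ^ rowsTail lam lam - 1 := by
      refine Dvd.dvd.trans ⟨-(1 + x)⁻¹, ?_⟩ (sub_one_dvd_pow_sub_one _ _)
      linear_combination h1
    have h3 : x ∣ ∏ i ∈ setE lam lam, (1 + x * MvPowerSeries.C (t ^ mult lam i)) - 1 :=
      dvd_prod_sub_one x _ _ fun i _ => ⟨MvPowerSeries.C (t ^ mult lam i), by ring⟩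
    obtain ⟨a, ha⟩ := h2
    obtain ⟨b, hb⟩ := h3
    refine ⟨a + b + x * a * b, ?_⟩
    rw [sub_eq_iff_eq_add.1 ha, sub_eq_iff_eq_add.1 hb]
    ring
  · rw [if_neg h, sub_zero]
    split_ifs with hs
    · have := card_lt hs.1 h
      refine Dvd.dvd.mul_right (Dvd.dvd.mul_left ?_ _) _
      exact (Dvd.intro _ rfl).trans (dvd_pow_self _ (by omega))
    · exact dvd_zero x

/-- `skewF` is the stable limit of the polynomials `polyF`. -/
theorem coeff_skewF {q : K} (hq : ∀ n : ℕ, 1 ≤ n → q ^ n ≠ 1) (lam mu : YoungDiagram)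
    (m : ℕ →₀ ℕ) (n : ℕ) (hn : ∀ i ∈ m.support, i < n) :
    MvPowerSeries.coeff m (skewF q lam mu) = MvPowerSeries.coeff m (polyF q n lam mu) :=
  coeff_branchLimit (isDeltaAtZero_oneF hq) lam mu m n hn

/-- `skewJ` is the stable limit of the functions `polyJ`. -/
theorem coeff_skewJ (t : K) (lam mu : YoungDiagram)
    (m : ℕ →₀ ℕ) (n : ℕ) (hn : ∀ i ∈ m.support, i < n) :
    MvPowerSeries.coeff m (skewJ t lam mu) = MvPowerSeries.coeff m (polyJ t n lam mu) :=
  coeff_branchLimit (isDeltaAtZero_oneJ t) lam mu m n hn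

end Functions
end
end InhomWhittaker

/-! Fix a partition `Lam` containing `lam` and `mu`, and let `H(x) = ∑ H_k x^k` and `V(x) = ∑ V_k
x^k` be the finite matrices, indexed by the partitions inside `Lam`, whose entries are the
one-variable `F_{lam/mu}(x)` and `J_{lam'/mu'}(x;q)`. The branching rule says that the functions of
several variables are entries of products of these matrices.

Record a partition by the numbers `m_j = lam_j - lam_{j+1}` of particles at sites `j`. Both matrices
then factor over sites: in `H` any number of particles hops from `j` to `j+1`'s other neighbour
independently at each site, while in `V` at most one particle crosses each edge, with weights of a
stochastic vertex model type. Two facts about them carry the proof.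

(1) `V(x) H(-x) = H(-qx)` (`sum_vertexProd_mul_hopProd`). This is proved site by site, from the
absorption and Pascal identities for `q`-binomials.

(2) `V(x)` and `V(y)` commute (`sum_vertexProd_mul_vertexProd`), by a Yang–Baxter exchange argument.

Comparing coefficients in (1) gives `((-q)^n - (-1)^n) H_n` as a combination of products `V_a H_b`
with `b < n`. Since `q^n ≠ 1`, every `H_n` lies in the commutative algebra `B` generated by the
`V_a` (`hopMatrix_mem_adjoin`).

Over `B` one may take logarithms. If `H(x) = exp(∑ a_n x^n)`, then `∏ H(x_i) = exp(∑ a_n p_n)`,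
which is symmetric and is explicitly a series in the power sums (`sum_coeff_pMon_smul_expCoeff`). By
(1), `log V(x) = log H(-qx) - log H(-x)` has coefficients `((-q)^n - (-1)^n) a_n = (-1)^(n-1) (1 -
q^n) a_n`. This is exactly the effect of `ω_q` on the exponent, so `ω_q` sends `∏ H(x_i)` to `∏
V(x_i)` (`omega_prodSeries`). Taking the entry at `lam`, `mu` gives the theorem. -/

namespace InhomWhittaker

noncomputable section

open Finset

/-! ### Local weights and their one-site identities -/

section Weights

variable {K A : Type*} [Field K] [CommRing A] [Algebra K A]

/-- The weight `x ^ k (x; q)_{m-k} [m choose k]_q` for moving `k` out of `m` particles. -/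
def hopWeight (q : K) (x : A) (m k : ℕ) : A :=
  if k ≤ m then x ^ k * qPoch x (algebraMap K A q) (m - k) *
    algebraMap K A (qPoch q q m / (qPoch q q k * qPoch q q (m - k))) else 0

/-- The weight of a site with `m` particles at which `i` particles arrive and from which `o`
particles leave, where `i, o ∈ {0, 1}`. Here `u` stands for `1 / (1 + x)`. -/
def vertexWeight (Q x u : A) (i o : ℤ) (m : ℕ) : A :=
  if i = 0 then
    if o = 0 then (1 + x * Q ^ m) * u else if o = 1 then (1 - Q ^ m) * (x * u) else 0
  else if i = 1 then
    if o = 0 then u else if o = 1 then x * u else 0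
  else 0

/-- The partition function of `n` sites in a row with edge variables in `{0, 1}`, where the last
edge variable is given and all the others are summed over. -/
def rowSum (g : ℕ → Bool → Bool → A) : ℕ → Bool → A
  | 0, _ => 1
  | n + 1, c => g n c false * rowSum g n false + g n c true * rowSum g n true

/-- Unrolls the recursion. The set `s` collects the occupied edges; edge `j` leaves site `j` and
edge `j + 1` enters it, so the entering edge of the last site is the prescribed `c`. -/
theorem rowSum_eq_sum (g : ℕ → Bool → Bool → A) (n : ℕ) (c : Bool) :
    rowSum g n c = ∑ s ∈ (range n).powerset, ∏ j ∈ range n,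
      g j (if j + 1 < n then decide (j + 1 ∈ s) else c) (decide (j ∈ s)) := by
  induction n generalizing c with
  | zero => simp [rowSum]
  | succ n ih =>
    rw [rowSum, ih, ih, range_add_one, sum_powerset_insert notMem_range_self, mul_sum, mul_sum]
    have key : ∀ s ∈ (range n).powerset, ∀ (b : Bool) (t : Finset ℕ), (n ∈ t ↔ b = true) →
        (∀ j < n, (j ∈ t ↔ j ∈ s)) →
        g n c b * ∏ j ∈ range n, g j (if j + 1 < n then decide (j + 1 ∈ s) else b)
          (decide (j ∈ s)) =
        ∏ j ∈ insert n (range n), g j (if j + 1 < n + 1 then decide (j + 1 ∈ t) else c)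
          (decide (j ∈ t)) := by
      intro s hs b t hb ht
      rw [prod_insert notMem_range_self]
      congr 1
      · rw [if_neg (lt_irrefl _)]
        simp [hb]
      · refine prod_congr rfl fun j hj => ?_
        rw [mem_range] at hj
        rw [if_pos (show j + 1 < n + 1 by omega)]
        simp only [ht j hj]
        congr 1
        split_ifs with h
        · simp only [ht _ h]
        · have : j + 1 = n := by omega
          simp [this, hb]
    have hn : ∀ s ∈ (range n).powerset, n ∉ s := fun s hs h =>
      notMem_range_self (mem_powerset.1 hs h)
    congr 1
    · refine sum_congr rfl fun s hs => key s hs false s (by simp [hn s hs]) (by simp)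
    · refine sum_congr rfl fun s hs => key s hs true _ (by simp) fun j hj => ?_
      simp [hj.ne]

theorem qPoch_succ (a Q : A) (k : ℕ) : qPoch a Q (k + 1) = qPoch a Q k * (1 - a * Q ^ k) :=
  prod_range_succ _ _

/-- Both sides are `(a; Q)_{k+1}`, with the first or the last factor split off. -/
theorem qPoch_mul_left (a Q : A) (k : ℕ) :
    qPoch (a * Q) Q k * (1 - a) = qPoch a Q k * (1 - a * Q ^ k) := by
  induction k with
  | zero => simp [qPoch]
  | succ k ih =>
    rw [qPoch_succ, qPoch_succ]
    linear_combination (1 - a * Q * Q ^ k) * ih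

theorem hopWeight_of_add (q : K) (x : A) (n k : ℕ) :
    hopWeight q x (k + n) k = x ^ k * qPoch x (algebraMap K A q) n *
      algebraMap K A (qPoch q q (k + n) / (qPoch q q k * qPoch q q n)) := by
  rw [hopWeight, if_pos (by omega), Nat.add_sub_cancel_left]

theorem hopWeight_eq_zero (q : K) (x : A) {m k : ℕ} (h : m < k) : hopWeight q x m k = 0 := by
  rw [hopWeight, if_neg (by omega)]

theorem qBinom_succ_succ {q : K} (hq : ∀ n : ℕ, 1 ≤ n → q ^ n ≠ 1) (n k : ℕ) :
    qPoch q q (k + 1 + n) / (qPoch q q (k + 1) * qPoch q q n) * (1 - q ^ (k + 1)) =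
      qPoch q q (k + n) / (qPoch q q k * qPoch q q n) * (1 - q ^ (k + 1 + n)) := by
  have h1 := qPoch_ne_zero hq k
  have h2 := qPoch_ne_zero hq n
  have h3 : 1 - q ^ (k + 1) ≠ 0 := sub_ne_zero.2 (hq (k + 1) (by omega)).symm
  have e1 : qPoch q q (k + 1 + n) = qPoch q q (k + n) * (1 - q ^ (k + 1 + n)) := by
    rw [show k + 1 + n = k + n + 1 by ring, qPoch_succ]; ring
  have e2 : qPoch q q (k + 1) = qPoch q q k * (1 - q ^ (k + 1)) := by
    rw [qPoch_succ]; ring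
  rw [e1, e2]
  field_simp

theorem qBinom_succ_right {q : K} (hq : ∀ n : ℕ, 1 ≤ n → q ^ n ≠ 1) (n k : ℕ) :
    qPoch q q (k + (n + 1)) / (qPoch q q k * qPoch q q (n + 1)) * (1 - q ^ (n + 1)) =
      qPoch q q (k + n) / (qPoch q q k * qPoch q q n) * (1 - q ^ (k + n + 1)) := by
  have := qBinom_succ_succ hq k n
  rw [show k + (n + 1) = n + 1 + k by ring, mul_comm (qPoch q q k), this, add_comm n k,
    mul_comm (qPoch q q n), show n + 1 + k = k + n + 1 by ring]

variable {q : K} {x u : A}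

/-- The shift `x ↦ qx` multiplies the monomial by `q^k`, and in `(-x; q)_n` it exchanges the first
factor `1 + x` for `1 + x q^n`. The weights at `-qx` and `-x` thus become comparable. -/
theorem hopWeight_mul_left (hu : u * (1 + x) = 1) (n k : ℕ) :
    hopWeight q (-(algebraMap K A q * x)) (k + n) k =
      algebraMap K A q ^ k * u * (1 + x * algebraMap K A q ^ n) * hopWeight q (-x) (k + n) k := by
  set Q := algebraMap K A q
  rw [hopWeight_of_add, hopWeight_of_add]
  have h := qPoch_mul_left (-x) Q n
  have h1 : qPoch (-(Q * x)) Q n = u * (qPoch (-x) Q n * (1 - -x * Q ^ n)) := by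
    rw [← h, show -(Q * x) = -x * Q by ring]
    linear_combination (-qPoch (-x * Q) Q n) * hu
  rw [h1, show -(Q * x) = Q * -x by ring, mul_pow]
  ring

/-- One-site form of `V(x) H(-x) = H(-qx)` with no arriving particle; the two terms are the cases of
zero or one departing particle. After cancelling common factors the terms in `x` agree, and what
remains is the absorption identity `[m,k] (1 - q^k) = [m-1,k-1] (1 - q^m)`. -/
theorem vertexWeight_hopWeight_zero (hq : ∀ n : ℕ, 1 ≤ n → q ^ n ≠ 1) (hu : u * (1 + x) = 1)
    (m k : ℕ) :
    (1 + x * algebraMap K A q ^ m) * u * hopWeight q (-x) m k +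
      (if 1 ≤ k then (1 - algebraMap K A q ^ m) * (x * u) * hopWeight q (-x) (m - 1) (k - 1)
        else 0) = hopWeight q (-(algebraMap K A q * x)) m k := by
  rcases lt_or_ge m k with h | h
  · rw [hopWeight_eq_zero _ _ h, hopWeight_eq_zero _ _ h, if_pos (by omega)]
    rcases Nat.eq_zero_or_pos m with rfl | hm
    · simp
    · rw [hopWeight_eq_zero _ _ (by omega)]; ring
  · obtain ⟨n, rfl⟩ := Nat.exists_eq_add_of_le h
    rw [hopWeight_mul_left hu]
    rcases k with _ | k
    · simp; ring
    · rw [if_pos (by omega), Nat.add_sub_cancel, show k + 1 + n - 1 = k + n by omega,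
        hopWeight_of_add, hopWeight_of_add]
      have h := congrArg (algebraMap K A) (qBinom_succ_succ hq n k)
      simp only [map_mul, map_sub, map_one, map_pow] at h
      linear_combination (-u * (-x) ^ k * x * qPoch (-x) (algebraMap K A q) n) * h

/-- The same with one arriving particle; it reduces to the Pascal rule `[m+1,k] = [m,k-1] + q^k
[m,k]`. The right side equals that of the case without arrival, and this is what makes the row sum
factor. -/
theorem vertexWeight_hopWeight_one (hq : ∀ n : ℕ, 1 ≤ n → q ^ n ≠ 1) (hu : u * (1 + x) = 1)
    (m k : ℕ) :
    u * hopWeight q (-x) (m + 1) k +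
      (if 1 ≤ k then x * u * hopWeight q (-x) m (k - 1) else 0) =
      hopWeight q (-(algebraMap K A q * x)) m k := by
  rcases lt_or_ge m k with h | h
  · rw [hopWeight_eq_zero _ (-(_ * x)) h, if_pos (by omega)]
    rcases k with _ | k
    · omega
    rcases (show m ≤ k by omega).eq_or_lt with rfl | h'
    · have e1 := hopWeight_of_add q (-x) 0 (m + 1)
      have e2 := hopWeight_of_add q (-x) 0 m
      have h1 := qPoch_ne_zero hq m
      have h2 := qPoch_ne_zero hq (m + 1)
      have h0 : qPoch q q 0 = 1 := by simp [qPoch]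
      simp only [add_zero, h0, mul_one, div_self h1, div_self h2, map_one] at e1 e2
      rw [e1, Nat.add_sub_cancel, e2]
      ring
    · rw [hopWeight_eq_zero _ _ (by omega), hopWeight_eq_zero _ _ (by omega)]; ring
  · obtain ⟨n, rfl⟩ := Nat.exists_eq_add_of_le h
    rw [hopWeight_mul_left hu, add_assoc k n 1, hopWeight_of_add, hopWeight_of_add, qPoch_succ (-x)]
    have hn : 1 - q ^ (n + 1) ≠ 0 := sub_ne_zero.2 (hq (n + 1) (by omega)).symm
    -- The binomial recursions are stated without division, so the identity is checked after
    -- multiplication by the unit `1 - q^(n+1)`.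
    have hreg : ∀ a b : A, a * (1 - algebraMap K A q ^ (n + 1)) =
        b * (1 - algebraMap K A q ^ (n + 1)) → a = b := by
      intro a b hab
      have hunit : IsUnit (1 - algebraMap K A q ^ (n + 1)) := by
        rw [← map_pow, ← map_one (algebraMap K A), ← map_sub]
        exact (isUnit_iff_ne_zero.2 hn).map _
      exact hunit.mul_right_cancel hab
    apply hreg
    have h := congrArg (algebraMap K A) (qBinom_succ_right hq n k)
    simp only [map_mul, map_sub, map_one, map_pow] at h
    rcases k with _ | k
    · simp only [zero_add, pow_zero, one_mul, if_neg (show ¬ 1 ≤ 0 by omega)] at h ⊢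
      linear_combination (u * qPoch (-x) (algebraMap K A q) n *
        (1 + x * algebraMap K A q ^ n)) * h
    · rw [if_pos (by omega), Nat.add_sub_cancel, show k + 1 + n = k + (n + 1) by ring,
        hopWeight_of_add, qPoch_succ (-x)]
      have h' := congrArg (algebraMap K A) (qBinom_succ_succ hq (n + 1) k)
      have h'' := congrArg (algebraMap K A) (qBinom_succ_succ hq n k)
      have h''' := congrArg (algebraMap K A) (qBinom_succ_right hq n k)
      simp only [map_mul, map_sub, map_one, map_pow] at h' h'' h'''
      simp only [show k + 1 + n = k + (n + 1) by ring] at h h''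
      set Q := algebraMap K A q
      linear_combination (u * (-x) ^ (k + 1) * qPoch (-x) Q n * (1 + x * Q ^ n)) * h
        + (x * u * (-x) ^ k * qPoch (-x) Q n * (1 + x * Q ^ n)) * (h''' - h'')

end Weights

/-! ### Young diagrams through their row lengths -/

section Diagrams

theorem le_iff_rowLen {lam mu : YoungDiagram} :
    mu ≤ lam ↔ ∀ r, mu.rowLen r ≤ lam.rowLen r := by
  constructor
  · intro h r
    by_contra! hc
    exact lt_irrefl _ (YoungDiagram.mem_iff_lt_rowLen.1
      (YoungDiagram.cells_subset_iff.2 h (YoungDiagram.mem_iff_lt_rowLen.2 hc)))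
  · intro h
    rw [← YoungDiagram.cells_subset_iff]
    rintro ⟨i, j⟩ hc
    exact YoungDiagram.mem_iff_lt_rowLen.2 ((YoungDiagram.mem_iff_lt_rowLen.1 hc).trans_le (h i))

theorem eq_of_rowLen {lam mu : YoungDiagram} (h : ∀ r, mu.rowLen r = lam.rowLen r) : mu = lam :=
  le_antisymm (le_iff_rowLen.2 fun r => (h r).le) (le_iff_rowLen.2 fun r => (h r).ge)

theorem lt_colLen_iff {lam : YoungDiagram} {i j : ℕ} : i < lam.colLen j ↔ j < lam.rowLen i := by
  rw [← YoungDiagram.mem_iff_lt_colLen, YoungDiagram.mem_iff_lt_rowLen]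

theorem rowLen_eq_zero_iff {lam : YoungDiagram} {r : ℕ} :
    lam.rowLen r = 0 ↔ lam.colLen 0 ≤ r := by
  rw [← not_lt, lt_colLen_iff]; omega

theorem rowLen_eq_zero_of_le {Lam lam : YoungDiagram} (h : lam ≤ Lam) {r : ℕ}
    (hr : Lam.colLen 0 ≤ r) : lam.rowLen r = 0 := by
  have := le_iff_rowLen.1 h r
  have := rowLen_eq_zero_iff.2 hr
  omega

theorem rowLen_succ_le (lam : YoungDiagram) (r : ℕ) : lam.rowLen (r + 1) ≤ lam.rowLen r :=
  lam.rowLen_anti _ _ (Nat.le_succ r)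

theorem exists_rowLen_eq (lam : YoungDiagram) (f : ℕ → ℕ) (hf : ∀ r, f (r + 1) ≤ f r)
    (hle : ∀ r, f r ≤ lam.rowLen r) : ∃ nu ≤ lam, ∀ r, nu.rowLen r = f r := by
  have hanti : Antitone f := antitone_nat_of_succ_le hf
  let nu : YoungDiagram :=
    { cells := {c ∈ lam.cells | c.2 < f c.1}
      isLowerSet := by
        rintro ⟨i, j⟩ ⟨i', j'⟩ ⟨hi, hj⟩ hc
        simp only [coe_filter, Set.mem_ofPred_eq, YoungDiagram.mem_cells] at hc ⊢
        simp only at hi hj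
        exact ⟨lam.up_left_mem hi hj hc.1, (hj.trans_lt hc.2).trans_le (hanti hi)⟩ }
  have hmem : ∀ i j, (i, j) ∈ nu ↔ j < f i := by
    intro i j
    change (i, j) ∈ filter _ _ ↔ _
    rw [mem_filter, YoungDiagram.mem_cells, YoungDiagram.mem_iff_lt_rowLen]
    exact ⟨fun h => h.2, fun h => ⟨h.trans_le (hle i), h⟩⟩
  have hrow : ∀ r, nu.rowLen r = f r := fun r => by
    apply le_antisymm
    · by_contra! h
      exact lt_irrefl _ ((hmem _ _).1 (YoungDiagram.mem_iff_lt_rowLen.2 h))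
    · by_contra! h
      exact lt_irrefl _ (YoungDiagram.mem_iff_lt_rowLen.1 ((hmem _ _).2 h))
  exact ⟨nu, le_iff_rowLen.2 fun r => (hrow r).trans_le (hle r), hrow⟩

/-- The partitions contained in `Lam` form a finite type. -/
instance fintypeLe (Lam : YoungDiagram) : Fintype {nu : YoungDiagram // nu ≤ Lam} :=
  (finite_le Lam).fintype

end Diagrams

/-! ### Transfer matrices: the relation with the `q`-Whittaker matrix, and commutation -/

section Transfer

variable {K A : Type*} [Field K] [CommRing A] [Algebra K A]

/-- The product of the weights of the first `l` sites for the `q`-Whittaker transfer matrix. -/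
def hopProd (q : K) (x : A) (l : ℕ) (lam mu : YoungDiagram) : A :=
  ∏ r ∈ range l, if mu.rowLen r ≤ lam.rowLen r then
    hopWeight q x (lam.rowLen r - lam.rowLen (r + 1)) (lam.rowLen r - mu.rowLen r) else 0

/-- The product of the weights of the first `l` sites for the Hall–Littlewood transfer matrix. -/
def vertexProd (Q x u : A) (l : ℕ) (lam mu : YoungDiagram) : A :=
  ∏ r ∈ range l, vertexWeight Q x u (lam.rowLen (r + 1) - mu.rowLen (r + 1) : ℤ)
    (lam.rowLen r - mu.rowLen r : ℤ) (lam.rowLen r - lam.rowLen (r + 1))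

theorem vertexWeight_ne_zero {Q x u : A} {i o : ℤ} {m : ℕ} (h : vertexWeight Q x u i o m ≠ 0) :
    (i = 0 ∨ i = 1) ∧ (o = 0 ∨ o = 1) := by
  unfold vertexWeight at h
  split_ifs at h <;> simp_all

theorem vertexProd_ne_zero {Q x u : A} {l : ℕ} {lam mu : YoungDiagram}
    (h : vertexProd Q x u l lam mu ≠ 0) (r : ℕ) (hr : r < l) :
    mu.rowLen r ≤ lam.rowLen r ∧ lam.rowLen r ≤ mu.rowLen r + 1 := by
  have h1 : vertexWeight Q x u (lam.rowLen (r + 1) - mu.rowLen (r + 1) : ℤ)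
      (lam.rowLen r - mu.rowLen r : ℤ) (lam.rowLen r - lam.rowLen (r + 1)) ≠ 0 :=
    fun h0 => h (prod_eq_zero (mem_range.2 hr) h0)
  have := (vertexWeight_ne_zero h1).2
  omega

/-- A sum over vertical strips is a sum over edge variables in `{0, 1}`. -/
theorem sum_eq_rowSum {Lam lam : YoungDiagram} (hlam : lam ≤ Lam)
    (H : {nu : YoungDiagram // nu ≤ Lam} → A) (g : ℕ → Bool → Bool → A)
    (hg : ∀ j, lam.rowLen j = lam.rowLen (j + 1) → g j false true = 0)
    (hH0 : ∀ nu, H nu ≠ 0 → ∀ r < Lam.colLen 0,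
      nu.1.rowLen r ≤ lam.rowLen r ∧ lam.rowLen r ≤ nu.1.rowLen r + 1)
    (hH : ∀ nu, (∀ r, nu.1.rowLen r ≤ lam.rowLen r ∧ lam.rowLen r ≤ nu.1.rowLen r + 1) →
      H nu = ∏ j ∈ range (Lam.colLen 0),
        g j (decide (nu.1.rowLen (j + 1) < lam.rowLen (j + 1)))
          (decide (nu.1.rowLen j < lam.rowLen j))) :
    ∑ nu, H nu = rowSum g (Lam.colLen 0) false := by
  classical
  have hz : ∀ nu : {nu : YoungDiagram // nu ≤ Lam}, ∀ r, Lam.colLen 0 ≤ r →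
      nu.1.rowLen r = 0 := fun nu r hr => rowLen_eq_zero_of_le nu.2 hr
  have hzl : ∀ r, Lam.colLen 0 ≤ r → lam.rowLen r = 0 := fun r hr => rowLen_eq_zero_of_le hlam hr
  have hH1 : ∀ nu, H nu ≠ 0 → ∀ r,
      nu.1.rowLen r ≤ lam.rowLen r ∧ lam.rowLen r ≤ nu.1.rowLen r + 1 := by
    intro nu h r
    rcases lt_or_ge r (Lam.colLen 0) with hr | hr
    · exact hH0 nu h r hr
    · simp [hz nu r hr, hzl r hr]
  rw [rowSum_eq_sum]
  refine sum_bij_ne_zero (fun nu _ _ => {r ∈ range (Lam.colLen 0) | nu.1.rowLen r < lam.rowLen r})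
    (fun nu _ _ => mem_powerset.2 (filter_subset _ _)) ?_ ?_ ?_
  · intro nu _ h1 nu' _ h2 heq
    refine Subtype.ext (eq_of_rowLen fun r => ?_)
    rcases lt_or_ge r (Lam.colLen 0) with hr | hr
    · have := congrArg (r ∈ ·) heq
      simp only [mem_filter, mem_range, hr, true_and, eq_iff_iff] at this
      have := hH1 nu h1 r
      have := hH1 nu' h2 r
      omega
    · rw [hz nu r hr, hz nu' r hr]
  · intro s hs hne
    rw [mem_powerset] at hs
    -- By `hg`, no particle leaves an empty site unless one arrives. So when two rows are equal and
    -- the upper one loses a box, the lower one does too, and removing the boxes leaves a partition.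
    have hstep : ∀ r ∈ s, lam.rowLen r = lam.rowLen (r + 1) → r + 1 ∈ s := by
      intro r hr he
      by_contra hc
      refine hne (prod_eq_zero (hs hr) ?_)
      rw [decide_eq_true hr, decide_eq_false hc, ite_self]
      exact hg r he
    have hpos : ∀ r ∈ s, 1 ≤ lam.rowLen r := by
      intro r hr
      by_contra! h0
      -- An empty row in `s` would force all later rows into `s`, but `s` is bounded by `Lam.colLen
      -- 0`.
      have hall : ∀ k, r + k ∈ s := by
        intro k
        induction k with
        | zero => exact hr
        | succ k ih =>
          have := lam.rowLen_anti r (r + k) (by omega)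
          have := rowLen_succ_le lam (r + k)
          have := hstep (r + k) ih (by omega)
          exact this
      have := mem_range.1 (hs (hall (Lam.colLen 0)))
      omega
    obtain ⟨nu, hnu, hrow⟩ := exists_rowLen_eq lam
      (fun r => lam.rowLen r - if r ∈ s then 1 else 0) (by
        intro r
        have := rowLen_succ_le lam r
        have h2 := hstep r
        by_cases h : r ∈ s
        · by_cases h' : r + 1 ∈ s
          · simp only [h, h', if_true]; omega
          · simp only [h, h', if_true, if_false]
            have : lam.rowLen r ≠ lam.rowLen (r + 1) := fun he => h' (h2 h he)
            omega
        · simp only [h, if_false]; omega) (fun r => Nat.sub_le _ _)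
    have hlt : ∀ r, nu.rowLen r < lam.rowLen r ↔ r ∈ s := by
      intro r
      rw [hrow]
      by_cases h : r ∈ s
      · have := hpos r h
        simp only [h, if_true, iff_true]; omega
      · simp [h]
    have hval := hH ⟨nu, hnu.trans hlam⟩ (by
      intro r
      simp only [hrow]
      split_ifs <;> omega)
    have hsv : H ⟨nu, hnu.trans hlam⟩ ≠ 0 := by
      rw [hval]
      convert hne using 1
      refine prod_congr rfl fun j hj => ?_
      simp only [hlt]
      congr 1
      split_ifs with h
      · rfl
      · simp only [decide_eq_false_iff_not]
        intro hc
        exact h (mem_range.1 (hs hc))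
    refine ⟨⟨nu, hnu.trans hlam⟩, mem_univ _, hsv, ?_⟩
    ext r
    simp only [mem_filter, hlt]
    exact ⟨fun h => h.2, fun h => ⟨hs h, h⟩⟩
  · intro nu _ h
    rw [hH nu (hH1 nu h)]
    refine prod_congr rfl fun j hj => ?_
    rw [mem_range] at hj
    simp only [mem_filter, mem_range, hj, true_and]
    congr 1
    split_ifs with h1
    · simp [h1]
    · rw [hzl _ (by omega)]; simp

/-- The edge variables are summed out one site at a time. By the one-site identities the sum over
the departing edge does not depend on the arriving edge, so the row sum is a product of hop weights
at `-qx`. -/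
theorem sum_vertexProd_mul_hopProd {q : K} {x u : A} (hq : ∀ n : ℕ, 1 ≤ n → q ^ n ≠ 1)
    (hu : u * (1 + x) = 1) {Lam lam mu : YoungDiagram} (hlam : lam ≤ Lam) :
    ∑ nu : {nu : YoungDiagram // nu ≤ Lam},
      vertexProd (algebraMap K A q) x u (Lam.colLen 0) lam nu *
        hopProd q (-x) (Lam.colLen 0) nu mu =
      hopProd q (-(algebraMap K A q * x)) (Lam.colLen 0) lam mu := by
  by_cases hmu : ∃ r < Lam.colLen 0, lam.rowLen r < mu.rowLen r
  · obtain ⟨r, hr, hlt⟩ := hmu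
    have h0 : hopProd q (-(algebraMap K A q * x)) (Lam.colLen 0) lam mu = 0 :=
      prod_eq_zero (mem_range.2 hr) (if_neg (by omega))
    rw [h0]
    refine sum_eq_zero fun nu _ => ?_
    by_contra hne
    have h1 := vertexProd_ne_zero (left_ne_zero_of_mul hne) r hr
    refine right_ne_zero_of_mul hne (prod_eq_zero (mem_range.2 hr) (if_neg (by omega)))
  push Not at hmu
  let m : ℕ → ℕ := fun j => lam.rowLen j - lam.rowLen (j + 1)
  let k : ℕ → ℕ := fun j => lam.rowLen j - mu.rowLen j
  -- After the vertex step, site `j` holds `m j + i - o` particles, of which `k j - o` still have to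
  -- move; the guard on `k j` expresses `mu_j ≤ nu_j` despite truncated subtraction.
  let g : ℕ → Bool → Bool → A := fun j i o =>
    vertexWeight (algebraMap K A q) x u (i.toNat : ℤ) (o.toNat : ℤ) (m j) *
      if o.toNat ≤ k j then hopWeight q (-x) (m j + i.toNat - o.toNat) (k j - o.toNat) else 0
  rw [sum_eq_rowSum hlam _ g]
  · have hsum : ∀ n c, rowSum g n c =
        ∏ j ∈ range n, hopWeight q (-(algebraMap K A q * x)) (m j) (k j) := by
      intro n
      induction n with
      | zero => simp [rowSum]
      | succ n ih =>
        intro c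
        rw [rowSum, ih, ih, ← add_mul, prod_range_succ, mul_comm]
        congr 1
        cases c
        · rw [← vertexWeight_hopWeight_zero hq hu]
          simp [g, vertexWeight]
        · rw [← vertexWeight_hopWeight_one hq hu]
          simp [g, vertexWeight]
    rw [hsum]
    refine prod_congr rfl fun j hj => ?_
    rw [if_pos (hmu j (mem_range.1 hj))]
  · intro j hj
    simp [g, m, hj, vertexWeight]
  · intro nu h
    exact vertexProd_ne_zero (left_ne_zero_of_mul h)
  · intro nu hs
    rw [vertexProd, hopProd, ← prod_mul_distrib]
    refine prod_congr rfl fun j hj => ?_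
    have key : ∀ r, ((decide (nu.1.rowLen r < lam.rowLen r)).toNat : ℕ) =
        lam.rowLen r - nu.1.rowLen r := by
      intro r
      have := hs r
      by_cases h : nu.1.rowLen r < lam.rowLen r
      · simp only [h, decide_true, Bool.toNat_true]; omega
      · simp only [h, decide_false, Bool.toNat_false]; omega
    have h1 := hs j
    have h2 := hs (j + 1)
    have h3 := rowLen_succ_le nu.1 j
    have h4 := rowLen_succ_le lam j
    have h5 := hmu j (mem_range.1 hj)
    simp only [g, m, k, key]
    rw [Nat.cast_sub h1.1, Nat.cast_sub h2.1]
    congr 1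
    have e1 : lam.rowLen j - nu.1.rowLen j ≤ lam.rowLen j - mu.rowLen j ↔
        mu.rowLen j ≤ nu.1.rowLen j := by omega
    simp only [e1]
    split_ifs with h
    · congr 1 <;> omega
    · rfl

/-- Yang–Baxter exchange: the two-row partition functions with parameters in either order are linked
by an `R`-matrix that is pushed through one site after another. Domain and `hxy` serve to cancel its
common denominator `x - Q y`. -/
theorem sum_vertexProd_mul_vertexProd [IsDomain A] {Q x y u v : A} (hxy : x - Q * y ≠ 0)
    {Lam lam mu : YoungDiagram} (hlam : lam ≤ Lam) (hmu : mu ≤ Lam) :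
    ∑ nu : {nu : YoungDiagram // nu ≤ Lam},
      vertexProd Q x u (Lam.colLen 0) lam nu * vertexProd Q y v (Lam.colLen 0) nu mu =
    ∑ nu : {nu : YoungDiagram // nu ≤ Lam},
      vertexProd Q y v (Lam.colLen 0) lam nu * vertexProd Q x u (Lam.colLen 0) nu mu := by
  let m : ℕ → ℕ := fun j => lam.rowLen j - lam.rowLen (j + 1)
  -- The number of particles crossing edge `j` in the two rows together. It is an integer, so an
  -- impossible second-row occupation becomes negative or exceeds `1` and has weight zero.
  let k : ℕ → ℤ := fun j => lam.rowLen j - mu.rowLen j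
  let g : A → A → A → A → ℕ → Bool → Bool → A := fun x u y v j i o =>
    vertexWeight Q x u (i.toNat : ℤ) (o.toNat : ℤ) (m j) *
      vertexWeight Q y v (k (j + 1) - i.toNat) (k j - o.toNat) (m j + i.toNat - o.toNat)
  have main : ∀ x u y v : A, ∑ nu : {nu : YoungDiagram // nu ≤ Lam},
      vertexProd Q x u (Lam.colLen 0) lam nu * vertexProd Q y v (Lam.colLen 0) nu mu =
      rowSum (g x u y v) (Lam.colLen 0) false := by
    intro x u y v
    refine sum_eq_rowSum hlam _ _ ?_ ?_ ?_
    · intro j hj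
      simp [g, m, hj, vertexWeight]
    · intro nu h
      exact vertexProd_ne_zero (left_ne_zero_of_mul h)
    · intro nu hs
      rw [vertexProd, vertexProd, ← prod_mul_distrib]
      refine prod_congr rfl fun j hj => ?_
      have key : ∀ r, ((decide (nu.1.rowLen r < lam.rowLen r)).toNat : ℕ) =
          lam.rowLen r - nu.1.rowLen r := by
        intro r
        have := hs r
        by_cases h : nu.1.rowLen r < lam.rowLen r
        · simp only [h, decide_true, Bool.toNat_true]; omega
        · simp only [h, decide_false, Bool.toNat_false]; omega
      have h1 := hs j
      have h2 := hs (j + 1)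
      have h3 := rowLen_succ_le nu.1 j
      have h4 := rowLen_succ_le lam j
      simp only [g, m, k, key]
      rw [Nat.cast_sub h1.1, Nat.cast_sub h2.1]
      congr 1
      congr 1 <;> omega
  rw [main, main]
  -- The Boolean is the edge variable of the first row. With `k n = 0` or `2` the split between the
  -- rows is forced; with `k n = 1` there are two splits, related by the `R`-matrix. Each row of its
  -- coefficients sums to `x - Q y`, which gives the case `n = 0`, where all row sums are `1`. At
  -- the far end `k = 0`, so the two sums agree.
  have claim : ∀ n,
      (k n = 0 → rowSum (g y v x u) n false = rowSum (g x u y v) n false) ∧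
      (k n = 2 → rowSum (g y v x u) n true = rowSum (g x u y v) n true) ∧
      (k n = 1 → (x - Q * y) * rowSum (g y v x u) n true =
          x * (1 - Q) * rowSum (g x u y v) n true + Q * (x - y) * rowSum (g x u y v) n false ∧
        (x - Q * y) * rowSum (g y v x u) n false =
          (x - y) * rowSum (g x u y v) n true + y * (1 - Q) * rowSum (g x u y v) n false) := by
    intro n
    induction n with
    | zero =>
      simp only [rowSum]
      refine ⟨fun _ => trivial, fun _ => trivial, fun _ => ⟨by ring, by ring⟩⟩
    | succ n ih =>
      obtain ⟨i0, i2, i1⟩ := ih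
      simp only [rowSum]
      generalize rowSum (g y v x u) n true = a1 at *
      generalize rowSum (g y v x u) n false = a0 at *
      generalize rowSum (g x u y v) n true = b1 at *
      generalize rowSum (g x u y v) n false = b0 at *
      by_cases k0 : k n = 0
      · have := i0 k0
        subst this
        refine ⟨fun h => ?_, fun h => ?_, fun h => ⟨?_, ?_⟩⟩ <;> simp [g, k0, h, vertexWeight, -mul_eq_mul_right_iff] <;>
          rcases m n with _ | _ | p <;> (try simp [-mul_eq_mul_right_iff]) <;> ring
      by_cases k2 : k n = 2
      · have := i2 k2
        subst this
        refine ⟨fun h => ?_, fun h => ?_, fun h => ⟨?_, ?_⟩⟩ <;> simp [g, k2, h, vertexWeight, -mul_eq_mul_right_iff] <;>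
          rcases m n with _ | _ | p <;> (try simp [-mul_eq_mul_right_iff]) <;> ring
      by_cases k1 : k n = 1
      · obtain ⟨e1, e0⟩ := i1 k1
        refine ⟨fun h => mul_left_cancel₀ hxy ?_, fun h => mul_left_cancel₀ hxy ?_,
          fun h => ⟨mul_left_cancel₀ hxy ?_, mul_left_cancel₀ hxy ?_⟩⟩
        · linear_combination (norm := skip) g y v x u n false false * e0 +
            g y v x u n false true * e1
          simp [g, k1, h, vertexWeight]
          rcases m n with _ | p <;> (try simp [-mul_eq_mul_right_iff]) <;> ring
        · linear_combination (norm := skip) g y v x u n true false * e0 +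
            g y v x u n true true * e1
          simp [g, k1, h, vertexWeight]
          rcases m n with _ | p <;> (try simp [-mul_eq_mul_right_iff]) <;> ring
        · linear_combination (norm := skip) (x - Q * y) * (g y v x u n true false * e0 +
            g y v x u n true true * e1)
          simp [g, k1, h, vertexWeight]
          rcases m n with _ | p <;> (try simp [-mul_eq_mul_right_iff]) <;> ring
        · linear_combination (norm := skip) (x - Q * y) * (g y v x u n false false * e0 +
            g y v x u n false true * e1)
          simp [g, k1, h, vertexWeight]
          rcases m n with _ | p <;> (try simp [-mul_eq_mul_right_iff]) <;> ring
      -- Two rows cannot carry a total occupation outside `{0, 1, 2}`.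
      · have hz : ∀ (x u y v : A) (i o : Bool), g x u y v n i o = 0 := by
          intro x u y v i o
          have : vertexWeight Q y v (k (n + 1) - i.toNat) (k n - o.toNat)
              (m n + i.toNat - o.toNat) = 0 := by
            by_contra h
            have := (vertexWeight_ne_zero h).2
            cases o
            · simp only [Bool.toNat_false, Nat.cast_zero] at this; omega
            · simp only [Bool.toNat_true, Nat.cast_one] at this; omega
          simp only [g]
          rw [this, mul_zero]
        simp [hz]
  refine ((claim _).1 ?_).symm
  simp only [k, rowLen_eq_zero_of_le hlam le_rfl, rowLen_eq_zero_of_le hmu le_rfl]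
  rfl

end Transfer

/-! ### The operator `x_i ∂/∂x_i` on products of power sums -/

section EulerOperator

variable {K : Type*} [Field K]

theorem coeff_X_mul_pderiv (i : ℕ) (f : MvPowerSeries ℕ K) (m : ℕ →₀ ℕ) :
    MvPowerSeries.coeff m (MvPowerSeries.X i * MvPowerSeries.pderiv K i f) =
      m i * MvPowerSeries.coeff m f := by
  classical
  rw [MvPowerSeries.X, mul_comm, MvPowerSeries.coeff_mul_monomial]
  split_ifs with h
  · have hm : m - Finsupp.single i 1 + Finsupp.single i 1 = m := tsub_add_cancel_of_le h
    have hi : (m - Finsupp.single i 1 : ℕ →₀ ℕ) i + 1 = m i := by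
      simpa using DFunLike.congr_fun hm i
    rw [MvPowerSeries.coeff_pderiv, hm, mul_one, mul_comm]
    rw [← hi]
    push_cast
    ring
  · have : m i = 0 := by
      by_contra h0
      exact h (by simpa using Nat.one_le_iff_ne_zero.2 h0)
    simp [this]

theorem X_mul_pderiv_pSum (i : ℕ) (n : ℕ+) :
    MvPowerSeries.X i * MvPowerSeries.pderiv K i (pSum K n) =
      MvPowerSeries.monomial (Finsupp.single i (n : ℕ)) ((n : ℕ) : K) := by
  classical
  ext m
  rw [coeff_X_mul_pderiv, coeff_pSum, MvPowerSeries.coeff_monomial]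
  by_cases h : m = Finsupp.single i (n : ℕ)
  · rw [if_pos ⟨i, h⟩, if_pos h, h]; simp
  · rw [if_neg h]
    split_ifs with h'
    · obtain ⟨j, rfl⟩ := h'
      have : j ≠ i := by rintro rfl; exact h rfl
      simp [this]
    · simp

/-- The Leibniz rule. Indices of `S` outside the support contribute zero through the factor `d n`,
so the truncated `d - single n 1` does no harm and `S` may be enlarged freely. -/
theorem X_mul_pderiv_pMon (i : ℕ) (S : Finset ℕ+) (d : ℕ+ →₀ ℕ) (hd : d.support ⊆ S) :
    MvPowerSeries.X i * MvPowerSeries.pderiv K i (pMon K d) =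
      ∑ n ∈ S, (d n : MvPowerSeries ℕ K) * (pMon K (d - Finsupp.single n 1) *
        (MvPowerSeries.X i * MvPowerSeries.pderiv K i (pSum K n))) := by
  classical
  induction d using finsupp_ind with
  | h0 => simp [pMon]
  | h1 d s ih =>
    have hds : d.support ⊆ S := fun n hn => hd (by
      simp only [Finsupp.mem_support_iff, Finsupp.add_apply] at hn ⊢; omega)
    have hs : s ∈ S := hd (by simp)
    rw [pMon_add_single, Derivation.leibniz, smul_eq_mul, smul_eq_mul, mul_add,
      mul_left_comm _ (pSum K s), ih hds, mul_left_comm, mul_sum]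
    have e : ∀ n ∈ S, (((d + Finsupp.single s 1 : ℕ+ →₀ ℕ) n : ℕ) : MvPowerSeries ℕ K) *
        (pMon K (d + Finsupp.single s 1 - Finsupp.single n 1) *
        (MvPowerSeries.X i * MvPowerSeries.pderiv K i (pSum K n))) =
        pSum K s * ((d n : MvPowerSeries ℕ K) * (pMon K (d - Finsupp.single n 1) *
        (MvPowerSeries.X i * MvPowerSeries.pderiv K i (pSum K n)))) +
        if n = s then pMon K d * (MvPowerSeries.X i * MvPowerSeries.pderiv K i (pSum K s))
          else 0 := by
      intro n _
      have h1 : (d n : MvPowerSeries ℕ K) * pMon K (d + Finsupp.single s 1 - Finsupp.single n 1) =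
          d n * (pSum K s * pMon K (d - Finsupp.single n 1)) := by
        rcases Nat.eq_zero_or_pos (d n) with h0 | h0
        · simp [h0]
        · rw [← tsub_add_eq_add_tsub (by simpa using Nat.succ_le_of_lt h0),
            pMon_add_single, mul_comm (pSum K s)]
      split_ifs with hn
      · subst hn
        simp only [Finsupp.add_apply, Finsupp.single_eq_same, Nat.cast_add, Nat.cast_one,
          add_tsub_cancel_right] at h1 ⊢
        linear_combination (MvPowerSeries.X i * MvPowerSeries.pderiv K i (pSum K n)) * h1
      · simp only [Finsupp.add_apply, Finsupp.single_eq_of_ne hn, add_zero]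
        linear_combination (MvPowerSeries.X i * MvPowerSeries.pderiv K i (pSum K n)) * h1
    rw [sum_congr rfl e, sum_add_distrib, sum_ite_eq' S s, if_pos hs, add_comm]

/-- The Euler operator multiplies the coefficient at `m` by `m i` and sends `p_n` to `n x_i^n`. This
yields a recursion that lowers the degree, used to identify the exponential. -/
theorem mul_coeff_pMon (i : ℕ) (M : ℕ+) (m : ℕ →₀ ℕ) (hM : m i = M) (d : ℕ+ →₀ ℕ) :
    (m i : K) * MvPowerSeries.coeff m (pMon K d) =
      ∑ n ∈ Icc 1 M, (((n : ℕ) : K) * d n) *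
        MvPowerSeries.coeff (m - Finsupp.single i (n : ℕ)) (pMon K (d - Finsupp.single n 1)) := by
  classical
  rw [← coeff_X_mul_pderiv, X_mul_pderiv_pMon i (d.support ∪ Icc 1 M) d subset_union_left, map_sum]
  symm
  have e : ∀ n : ℕ+, MvPowerSeries.coeff m ((d n : MvPowerSeries ℕ K) *
      (pMon K (d - Finsupp.single n 1) *
        (MvPowerSeries.X i * MvPowerSeries.pderiv K i (pSum K n)))) =
      if n ≤ M then (((n : ℕ) : K) * d n) *
        MvPowerSeries.coeff (m - Finsupp.single i (n : ℕ)) (pMon K (d - Finsupp.single n 1))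
      else 0 := by
    intro n
    rw [X_mul_pderiv_pSum, ← nsmul_eq_mul, map_nsmul, MvPowerSeries.coeff_mul_monomial]
    have hle : Finsupp.single i (n : ℕ) ≤ m ↔ n ≤ M := by
      rw [Finsupp.single_le_iff, hM, PNat.coe_le_coe]
    simp only [hle]
    split_ifs
    · rw [nsmul_eq_mul]; ring
    · simp
  simp only [e]
  rw [← sum_filter]
  refine sum_subset (fun n hn => ?_) fun n hn hn' => ?_
  · simp only [mem_Icc] at hn
    simp [hn.2]
  · simp only [mem_filter, mem_Icc, one_le, true_and] at hn hn'
    exact absurd hn.2 hn'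

end EulerOperator

/-! ### Exponentials in power sums and the action of `ω_q` on them -/

section Exponential

variable {K B : Type*} [Field K] [CommRing B] [Algebra K B]

variable (K) in
/-- The coefficient of `∏ n, P_n ^ (d n)` in `exp (∑ n, a n * P_n)`. -/
def expCoeff (a : ℕ+ → B) (d : ℕ+ →₀ ℕ) : B :=
  d.prod fun n k => ((k.factorial : K)⁻¹) • a n ^ k

/-- Coefficient form of `∂/∂P_n exp(∑ a_n P_n) = a_n exp(∑ a_n P_n)`. -/
theorem expCoeff_add_single [CharZero K] (a : ℕ+ → B) (d : ℕ+ →₀ ℕ) (n : ℕ+) :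
    ((d n : K) + 1) • expCoeff K a (d + Finsupp.single n 1) = a n * expCoeff K a d := by
  classical
  unfold expCoeff
  rw [← Finsupp.mul_prod_erase' _ n _ (by simp), ← Finsupp.mul_prod_erase' d n _ (by simp)]
  have he : (d + Finsupp.single n 1).erase n = d.erase n := by
    rw [Finsupp.erase_add, Finsupp.erase_single, add_zero]
  have hk : (d n : K) + 1 ≠ 0 := by exact_mod_cast Nat.succ_ne_zero (d n)
  rw [he, Finsupp.add_apply, Finsupp.single_eq_same, Nat.factorial_succ, smul_mul_assoc, smul_smul,
    Nat.cast_mul, mul_inv, Nat.cast_succ, mul_inv_cancel_left₀ hk, pow_succ, smul_mul_assoc,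
    mul_smul_comm]
  congr 1
  ring

theorem expCoeff_mul (c : ℕ+ → K) (a : ℕ+ → B) (d : ℕ+ →₀ ℕ) :
    expCoeff K (fun n => c n • a n) d = (d.prod fun n k => c n ^ k) • expCoeff K a d := by
  unfold expCoeff
  simp only [Finsupp.prod, Algebra.smul_def, mul_pow, map_prod, ← prod_mul_distrib, map_pow]
  refine prod_congr rfl fun n _ => by ring

/-- The power series `∑ n, n * a n * X ^ n`. -/
def eulerSeries (a : ℕ+ → B) : PowerSeries B :=
  -- At `n = 0` the default value of `toPNat'` is multiplied by `0`.
  PowerSeries.mk fun n => (n : B) * a n.toPNat'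

theorem coeff_eulerSeries (a : ℕ+ → B) (n : ℕ+) :
    PowerSeries.coeff n (eulerSeries a) = ((n : ℕ) : B) * a n := by
  simp [eulerSeries]

theorem coeff_eulerSeries_mul (a : ℕ+ → B) (T : PowerSeries B) (k : ℕ+) :
    PowerSeries.coeff k (eulerSeries a * T) =
      ∑ n ∈ Icc 1 k, ((n : ℕ) : B) * a n * PowerSeries.coeff (k - n : ℕ) T := by
  classical
  rw [PowerSeries.coeff_mul]
  symm
  refine sum_bij_ne_zero (fun n _ _ => ((n : ℕ), (k : ℕ) - n)) ?_ ?_ ?_ ?_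
  · intro n hn _
    have : (n : ℕ) ≤ k := PNat.coe_le_coe _ _ |>.2 (mem_Icc.1 hn).2
    simp only [HasAntidiagonal.mem_antidiagonal]; omega
  · intro n _ _ n' _ _ h
    exact PNat.coe_injective (Prod.mk.inj h).1
  · rintro ⟨i, j⟩ hij hne
    rw [HasAntidiagonal.mem_antidiagonal] at hij
    have hi : 0 < i := by
      by_contra! h0
      apply hne
      obtain rfl : i = 0 := by omega
      simp [eulerSeries]
    have hk : i ≤ k := by simp only at hij; omega
    have hj : (k : ℕ) - i = j := by simp only at hij; omega
    lift i to ℕ+ using hi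
    refine ⟨i, mem_Icc.2 ⟨one_le, PNat.coe_le_coe _ _ |>.1 hk⟩, ?_, ?_⟩
    · rw [← coeff_eulerSeries]
      simpa [hj] using hne
    · simp [hj]
  · intro n _ _
    rw [coeff_eulerSeries]

theorem coeff_X_mul_derivative (T : PowerSeries B) (k : ℕ) :
    PowerSeries.coeff k (PowerSeries.X * PowerSeries.derivative B T) =
      k * PowerSeries.coeff k T := by
  cases k with
  | zero => simp
  | succ k =>
    rw [PowerSeries.coeff_succ_X_mul, PowerSeries.coeff_derivative]
    push_cast
    ring

/-- The logarithm, encoded by its Euler derivative: `A = X T' / T` exists since `T` has constant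
term `1`, and `a_n = A_n / n` since the characteristic is zero. -/
theorem exists_eulerSeries (K : Type*) {B : Type*} [Field K] [CharZero K] [CommRing B]
    [Algebra K B] (T : PowerSeries B) (hT : PowerSeries.constantCoeff T = 1) :
    ∃ a : ℕ+ → B, PowerSeries.X * PowerSeries.derivative B T = eulerSeries a * T := by
  have hinv : T * PowerSeries.invOfUnit T 1 = 1 :=
    PowerSeries.mul_invOfUnit T 1 (by simp [hT])
  set A := PowerSeries.X * PowerSeries.derivative B T * PowerSeries.invOfUnit T 1 with hA
  refine ⟨fun n => ((n : ℕ) : K)⁻¹ • PowerSeries.coeff n A, ?_⟩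
  have : eulerSeries (fun n : ℕ+ => ((n : ℕ) : K)⁻¹ • PowerSeries.coeff n A) = A := by
    ext n
    rcases Nat.eq_zero_or_pos n with rfl | hn
    · simp [eulerSeries, hA, mul_assoc]
    · have hn' : (n : K) ≠ 0 := Nat.cast_ne_zero.2 hn.ne'
      lift n to ℕ+ using hn
      rw [coeff_eulerSeries]
      rw [← map_natCast (algebraMap K B), ← Algebra.smul_def, smul_smul, mul_inv_cancel₀ hn',
        one_smul]
  rw [this, hA]
  linear_combination (-PowerSeries.X * PowerSeries.derivative B T) * hinv

/-- The product `∏ i, T (X i)` is the exponential of `∑ n, a n * p_n` if `T` is the exponential of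
`∑ n, a n * X ^ n`. -/
theorem sum_coeff_pMon_smul_expCoeff [CharZero K] (a : ℕ+ → B) (T : PowerSeries B)
    (hT : PowerSeries.constantCoeff T = 1)
    (ha : PowerSeries.X * PowerSeries.derivative B T = eulerSeries a * T) (m : ℕ →₀ ℕ) :
    ∑ d ∈ (finite_wt m.degree).toFinset, MvPowerSeries.coeff m (pMon K d) • expCoeff K a d =
      m.prod fun _ k => PowerSeries.coeff k T := by
  classical
  have hT0 : PowerSeries.coeff 0 T = 1 := by simpa using hT
  induction hw : m.degree using Nat.strong_induction_on generalizing m with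
  | _ w ih =>
  rcases eq_or_ne m 0 with rfl | hm
  · have hw0 : w = 0 := by simpa using hw.symm
    subst hw0
    rw [sum_eq_single (0 : ℕ+ →₀ ℕ)]
    · simp [pMon, expCoeff]
    · intro d hd hne
      exfalso
      rw [Set.Finite.mem_toFinset, Set.mem_ofPred_eq] at hd
      obtain ⟨s, hs⟩ := Finsupp.ne_iff.1 hne
      have := Finset.single_le_sum (f := fun s : ℕ+ => d s * (s : ℕ)) (fun _ _ => Nat.zero_le _)
        (Finsupp.mem_support_iff.2 hs)
      have h2 : 0 < d s * (s : ℕ) := Nat.mul_pos (Nat.pos_of_ne_zero hs) s.pos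
      have h3 : (∑ x ∈ d.support, d x * (x : ℕ)) = 0 := hd
      omega
    · intro h
      exact absurd (by simp [wt]) h
  obtain ⟨i, hi⟩ := Finsupp.ne_iff.1 hm
  have hi : m i ≠ 0 := hi
  obtain ⟨M, hM⟩ : ∃ M : ℕ+, m i = M := ⟨⟨m i, Nat.pos_of_ne_zero hi⟩, rfl⟩
  have hiK : (m i : K) ≠ 0 := Nat.cast_ne_zero.2 hi
  have hle : ∀ n ∈ Icc 1 M, Finsupp.single i (n : ℕ) ≤ m := by
    intro n hn
    rw [Finsupp.single_le_iff, hM, PNat.coe_le_coe]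
    exact (mem_Icc.1 hn).2
  have hdeg : ∀ n ∈ Icc 1 M, (m - Finsupp.single i (n : ℕ)).degree + n = w := by
    intro n hn
    have := congrArg Finsupp.degree (tsub_add_cancel_of_le (hle n hn))
    rw [← hw, ← this]
    simp
  have hsmul : ∀ x y : B, (m i : K) • x = (m i : K) • y → x = y := fun x y h => by
    have := congrArg (fun z => (m i : K)⁻¹ • z) h
    simpa [smul_smul, hiK] using this
  -- Induction on the degree: for a variable `x_i` occurring in `m`, the Euler operator turns the
  -- sum into `∑ n a_n` times sums of lower degree, and `X T' = (∑ n a_n X^n) T` reassembles the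
  -- product.
  apply hsmul
  rw [smul_sum]
  simp only [smul_smul, mul_coeff_pMon i M m hM, sum_smul]
  rw [sum_comm]
  have inner : ∀ n ∈ Icc 1 M, ∑ d ∈ (finite_wt w).toFinset,
      ((((n : ℕ) : K) * d n) * MvPowerSeries.coeff (m - Finsupp.single i (n : ℕ))
        (pMon K (d - Finsupp.single n 1))) • expCoeff K a d =
      (((n : ℕ) : B) * a n) * (PowerSeries.coeff (M - n : ℕ) T *
        (m.erase i).prod fun _ k => PowerSeries.coeff k T) := by
    intro n hn
    have hn0 := n.pos
    have hprod : (m - Finsupp.single i (n : ℕ)).prod (fun _ k => PowerSeries.coeff k T) =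
        PowerSeries.coeff (M - n : ℕ) T * (m.erase i).prod fun _ k => PowerSeries.coeff k T := by
      rw [← Finsupp.mul_prod_erase' _ i _ (by simp [hT0])]
      congr 2
      · simp [hM]
      · ext j
        by_cases hj : j = i
        · simp [hj]
        · simp [Finsupp.erase_ne hj, Finsupp.single_eq_of_ne hj]
    rw [← hprod, ← ih _ (by have := hdeg n hn; omega) _ rfl, mul_sum]
    have val : ∀ d, ((n : ℕ) : B) * a n * MvPowerSeries.coeff (m - Finsupp.single i (n : ℕ))
        (pMon K d) • expCoeff K a d = ((((n : ℕ) : K) * ((d + Finsupp.single n 1 : ℕ+ →₀ ℕ) n : ℕ)) *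
        MvPowerSeries.coeff (m - Finsupp.single i (n : ℕ))
          (pMon K (d + Finsupp.single n 1 - Finsupp.single n 1))) •
          expCoeff K a (d + Finsupp.single n 1) := by
      intro d
      have h2 := expCoeff_add_single (K := K) a d n
      rw [add_tsub_cancel_right, Finsupp.add_apply, Finsupp.single_eq_same, Nat.cast_succ]
      simp only [Algebra.smul_def, map_mul, map_natCast, map_add, map_one] at h2 ⊢
      linear_combination (-(n : ℕ) * algebraMap K B
        (MvPowerSeries.coeff (m - Finsupp.single i (n : ℕ)) (pMon K d))) * h2
    symm
    -- Reindexing by removal of one factor `p_n`; terms with `d n = 0` vanish.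
    refine sum_bij_ne_zero (fun d _ _ => d + Finsupp.single n 1) ?_ ?_ ?_ ?_
    · intro d hd _
      simp only [Set.Finite.mem_toFinset, Set.mem_ofPred_eq] at hd ⊢
      rw [wt_add_single, hd, hdeg n hn]
    · intro d _ _ d' _ _ h
      exact add_right_cancel h
    · intro d hd hne
      have hdn : d n ≠ 0 := by
        intro h0
        apply hne
        simp [h0]
      have hd' : d - Finsupp.single n 1 + Finsupp.single n 1 = d :=
        tsub_add_cancel_of_le (by simpa using Nat.one_le_iff_ne_zero.2 hdn)
      refine ⟨d - Finsupp.single n 1, ?_, ?_, hd'⟩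
      · simp only [Set.Finite.mem_toFinset, Set.mem_ofPred_eq] at hd ⊢
        have h1 := wt_add_single (d - Finsupp.single n 1) n
        rw [hd', hd] at h1
        have := hdeg n hn
        omega
      · rw [val, hd']
        exact hne
    · intro d _ _
      exact val d
  rw [sum_congr rfl inner, ← Finsupp.mul_prod_erase' m i _ (by simp [hT0]), Algebra.smul_def,
    ← mul_assoc, map_natCast, hM, ← coeff_X_mul_derivative, ha, coeff_eulerSeries_mul, sum_mul]
  exact sum_congr rfl fun n _ => by ring

/-- The symmetric series `∏ i, T (X i)`, with a linear form applied to its coefficients. -/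
def prodSeries (e : B →ₗ[K] K) (T : PowerSeries B) : MvPowerSeries ℕ K :=
  fun m => e (m.prod fun _ k => PowerSeries.coeff k T)

theorem coeff_prodSeries (e : B →ₗ[K] K) (T : PowerSeries B) (m : ℕ →₀ ℕ) :
    MvPowerSeries.coeff m (prodSeries e T) = e (m.prod fun _ k => PowerSeries.coeff k T) := rfl

/-- The series `exp (∑ n, a n * P_n)`, with a linear form applied to its coefficients. -/
def expSeries (e : B →ₗ[K] K) (a : ℕ+ → B) : MvPowerSeries ℕ+ K :=
  fun d => e (expCoeff K a d)

theorem coeff_expSeries (e : B →ₗ[K] K) (a : ℕ+ → B) (d : ℕ+ →₀ ℕ) :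
    MvPowerSeries.coeff d (expSeries e a) = e (expCoeff K a d) := rfl

theorem pEval_expSeries [CharZero K] (e : B →ₗ[K] K) (a : ℕ+ → B) (T : PowerSeries B)
    (hT : PowerSeries.constantCoeff T = 1)
    (ha : PowerSeries.X * PowerSeries.derivative B T = eulerSeries a * T) :
    (pEval K (expSeries e a) : MvPowerSeries ℕ K) = prodSeries e T := by
  ext m
  rw [coeff_pEval, coeff_prodSeries, ← sum_coeff_pMon_smul_expCoeff (K := K) a T hT ha m, map_sum,
    finsum_eq_sum_of_support_subset (s := (finite_wt m.degree).toFinset)]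
  · refine sum_congr rfl fun d _ => ?_
    rw [map_smul, smul_eq_mul, coeff_expSeries, mul_comm]
  · intro d hd
    rw [Set.Finite.coe_toFinset, Set.mem_ofPred_eq]
    by_contra h
    exact hd (by simp only [coeff_pMon_eq_zero h, mul_zero])

theorem X_mul_derivative_rescale (c : B) (T : PowerSeries B) :
    PowerSeries.X * PowerSeries.derivative B (PowerSeries.rescale c T) =
      PowerSeries.rescale c (PowerSeries.X * PowerSeries.derivative B T) := by
  ext k
  rw [coeff_X_mul_derivative, PowerSeries.coeff_rescale, PowerSeries.coeff_rescale,
    coeff_X_mul_derivative]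
  ring

/-- The effect of `ω_q` on `∏ i, T (X i)`. -/
theorem omega_prodSeries [CharZero K] (q : K) (e : B →ₗ[K] K) (T J : PowerSeries B)
    (hT : PowerSeries.constantCoeff T = 1)
    (hJT : J * PowerSeries.rescale (-1) T = PowerSeries.rescale (-algebraMap K B q) T) :
    ∃ (hF : prodSeries e T ∈ SymSeries K) (hJ : prodSeries e J ∈ SymSeries K),
      omega q 0 ⟨prodSeries e T, hF⟩ = ⟨prodSeries e J, hJ⟩ := by
  have hT0 : PowerSeries.coeff 0 T = 1 := by simpa using hT
  have hr : ∀ c : B, PowerSeries.constantCoeff (PowerSeries.rescale c T) = 1 := by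
    intro c
    rw [← PowerSeries.coeff_zero_eq_constantCoeff_apply, PowerSeries.coeff_rescale, hT0]
    simp
  have hJ : PowerSeries.constantCoeff J = 1 := by
    have := congrArg PowerSeries.constantCoeff hJT
    rwa [map_mul, hr, hr, mul_one] at this
  obtain ⟨a, ha⟩ := exists_eulerSeries K T hT
  let c : ℕ+ → K := fun n => (-1) ^ ((n : ℕ) - 1) * ((1 - q ^ (n : ℕ)) / (1 - 0 ^ (n : ℕ)))
  -- This is `(-q)^n - (-1)^n = (-1)^(n-1) (1 - q^n)`; the denominator is `1 - 0^n = 1` because `n ≥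
  -- 1`.
  have hA : eulerSeries (fun n => c n • a n) =
      PowerSeries.rescale (-algebraMap K B q) (eulerSeries a) -
        PowerSeries.rescale (-1) (eulerSeries a) := by
    ext n
    rw [map_sub, PowerSeries.coeff_rescale, PowerSeries.coeff_rescale]
    rcases Nat.eq_zero_or_pos n with rfl | hn
    · simp [eulerSeries]
    · lift n to ℕ+ using hn
      rw [coeff_eulerSeries, coeff_eulerSeries]
      obtain ⟨k, hk⟩ := Nat.exists_eq_succ_of_ne_zero n.pos.ne'
      simp only [c, hk, Nat.succ_eq_add_one, Nat.add_sub_cancel, Algebra.smul_def, map_mul,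
        map_pow, map_neg, map_one, map_sub, zero_pow (Nat.succ_ne_zero k), sub_zero,
        div_one]
      rw [neg_pow (algebraMap K B q)]
      ring
  -- Logarithmic differentiation of `hJT`; the series `T(-X)` is cancelled through its inverse.
  have hJa : PowerSeries.X * PowerSeries.derivative B J =
      eulerSeries (fun n => c n • a n) * J := by
    have h := congrArg (fun S => PowerSeries.X * PowerSeries.derivative B S) hJT
    simp only [Derivation.leibniz, smul_eq_mul] at h
    rw [mul_add, mul_left_comm, X_mul_derivative_rescale, X_mul_derivative_rescale, ha, map_mul,
      map_mul, ← hJT] at h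
    have hinv : PowerSeries.rescale (-1) T * PowerSeries.invOfUnit (PowerSeries.rescale (-1) T) 1
        = 1 := PowerSeries.mul_invOfUnit _ 1 (by simp [hr])
    rw [hA]
    linear_combination PowerSeries.invOfUnit (PowerSeries.rescale (-1) T) 1 * h -
      (PowerSeries.X * PowerSeries.derivative B J -
        (PowerSeries.rescale (-algebraMap K B q) (eulerSeries a) -
        PowerSeries.rescale (-1) (eulerSeries a)) * J) * hinv
  have eF := pEval_expSeries e a T hT ha
  have eJ := pEval_expSeries e _ J hJ hJa
  refine ⟨eF ▸ (pEval K _).2, eJ ▸ (pEval K _).2, ?_⟩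
  have h1 : (⟨prodSeries e T, eF ▸ (pEval K _).2⟩ : SymSeries K) = pEquiv K (expSeries e a) :=
    Subtype.ext eF.symm
  have h2 : (⟨prodSeries e J, eJ ▸ (pEval K _).2⟩ : SymSeries K) =
      pEquiv K (expSeries e fun n => c n • a n) := Subtype.ext eJ.symm
  rw [h1, h2]
  simp only [omega, AlgHom.comp_apply, AlgEquiv.toAlgHom_apply, AlgEquiv.symm_apply_apply]
  congr 1
  ext d
  rw [MvPowerSeries.rescaleAlgHom_apply, MvPowerSeries.coeff_rescale, coeff_expSeries,
    coeff_expSeries, expCoeff_mul, map_smul, smul_eq_mul]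

end Exponential

/-! ### From the combinatorial formulas to products over sites -/

section Translation

/-- Interlacing of rows. A failure on either side is tested at the first cell missing from `mu` in
the row or column concerned. -/
theorem isHorizontalStrip_iff {lam mu : YoungDiagram} :
    IsHorizontalStrip mu lam ↔
      ∀ r, lam.rowLen (r + 1) ≤ mu.rowLen r ∧ mu.rowLen r ≤ lam.rowLen r := by
  rw [IsHorizontalStrip, le_iff_rowLen, forall_and, and_comm]
  refine and_congr_left fun _ => ⟨fun h r => ?_, fun h j => ?_⟩
  · by_contra! hc
    have h1 := lt_colLen_iff.2 hc
    have h2 : ¬ r < mu.colLen (mu.rowLen r) := by rw [lt_colLen_iff]; exact lt_irrefl _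
    have := h (mu.rowLen r)
    omega
  · by_contra! hc
    have h1 := lt_colLen_iff.1 hc
    have h2 : ¬ j < mu.rowLen (mu.colLen j) := by rw [← lt_colLen_iff]; exact lt_irrefl _
    have := h (mu.colLen j)
    omega

theorem isHorizontalStrip_transpose_iff {lam mu : YoungDiagram} :
    IsHorizontalStrip mu.transpose lam.transpose ↔
      ∀ r, mu.rowLen r ≤ lam.rowLen r ∧ lam.rowLen r ≤ mu.rowLen r + 1 := by
  rw [IsHorizontalStrip, YoungDiagram.transpose_le_iff, le_iff_rowLen, forall_and]
  simp only [YoungDiagram.colLen_transpose]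

theorem card_eq_sum_rowLen {Lam lam : YoungDiagram} (h : lam ≤ Lam) :
    lam.card = ∑ r ∈ range (Lam.colLen 0), lam.rowLen r := by
  rw [YoungDiagram.card, card_eq_sum_card_fiberwise (f := Prod.fst) (t := range (Lam.colLen 0))]
  · exact sum_congr rfl fun r _ => (lam.rowLen_eq_card).symm
  · rintro ⟨i, j⟩ hc
    have h1 := YoungDiagram.mem_iff_lt_rowLen.1 (YoungDiagram.mem_cells _ |>.1 hc)
    simp only [coe_range, Set.mem_Iio]
    by_contra! h2
    rw [rowLen_eq_zero_of_le h h2] at h1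
    omega

theorem card_sub_card {Lam lam mu : YoungDiagram} (h : lam ≤ Lam) (hmu : mu ≤ lam) :
    lam.card - mu.card = ∑ r ∈ range (Lam.colLen 0), (lam.rowLen r - mu.rowLen r) := by
  rw [card_eq_sum_rowLen h, card_eq_sum_rowLen (hmu.trans h),
    sum_tsub_distrib _ fun r _ => le_iff_rowLen.1 hmu r]

theorem card_transpose (lam : YoungDiagram) : lam.transpose.card = lam.card := by
  refine card_bij (fun c _ => c.swap) ?_ ?_ ?_
  · intro c hc
    simpa [YoungDiagram.mem_transpose] using hc
  · intro c _ c' _ h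
    exact Prod.swap_injective h
  · intro c hc
    exact ⟨c.swap, by simpa [YoungDiagram.mem_transpose] using hc, by simp⟩

variable {K : Type*} [Field K]

/-- The exponent `|lam| - |mu|` is distributed over the rows, sites beyond `lam` have weight `1`,
and a failure of interlacing makes some hop weight vanish. -/
theorem oneF_eq_hopProd (q : K) (x : MvPowerSeries ℕ K) {Lam lam mu : YoungDiagram}
    (hlam : lam ≤ Lam) (hmu : mu ≤ Lam) :
    oneF q lam mu x = hopProd q x (Lam.colLen 0) lam mu := by
  classical
  unfold oneF
  split_ifs with h
  · have hs := isHorizontalStrip_iff.1 h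
    have hext : lam.colLen 0 ≤ Lam.colLen 0 := by
      rw [← rowLen_eq_zero_iff]; exact rowLen_eq_zero_of_le hlam le_rfl
    rw [prod_subset (range_mono hext), card_sub_card hlam h.1, ← prod_pow_eq_pow_sum,
      ← prod_mul_distrib]
    · refine prod_congr rfl fun r _ => ?_
      have h1 := hs r
      have e : lam.rowLen r - lam.rowLen (r + 1) - (lam.rowLen r - mu.rowLen r) =
        mu.rowLen r - lam.rowLen (r + 1) := by omega
      rw [if_pos h1.2, hopWeight, if_pos (by omega), mul_assoc, e]
      rfl
    · intro r _ hr
      rw [mem_range, not_lt, ← rowLen_eq_zero_iff] at hr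
      have h1 := hs r
      have h2 := rowLen_succ_le lam r
      rw [show mu.rowLen r = 0 by omega, hr, show lam.rowLen (r + 1) = 0 by omega]
      simp [qPoch]
  · rw [isHorizontalStrip_iff] at h
    push Not at h
    obtain ⟨r, hr⟩ := h
    have hrl : r < Lam.colLen 0 := by
      by_contra! hc
      have h1 := rowLen_eq_zero_of_le hlam hc
      have h2 := rowLen_eq_zero_of_le hmu hc
      have h3 := rowLen_succ_le lam r
      have := hr (by omega)
      omega
    symm
    refine prod_eq_zero (mem_range.2 hrl) ?_
    split_ifs with hle
    · refine hopWeight_eq_zero _ _ ?_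
      have h3 := rowLen_succ_le lam r
      by_contra! hc
      have := hr (by omega)
      omega
    · rfl

theorem mult_transpose (lam : YoungDiagram) (j : ℕ) :
    mult lam.transpose (j + 1) = lam.rowLen j - lam.rowLen (j + 1) := by
  rw [mult, ← Nat.card_Ico]
  congr 1
  ext r
  simp only [YoungDiagram.colLen_transpose, YoungDiagram.rowLen_transpose, mem_filter, mem_range,
    mem_Ico]
  have h1 : j < lam.colLen r ↔ r < lam.rowLen j := lt_colLen_iff
  have h2 : j + 1 < lam.colLen r ↔ r < lam.rowLen (j + 1) := lt_colLen_iff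
  have h3 := lam.rowLen_anti 0 j (Nat.zero_le j)
  omega

theorem prod_Icc_one {M : Type*} [CommMonoid M] (f : ℕ → M) (n : ℕ) :
    ∏ i ∈ Icc 1 n, f i = ∏ j ∈ range n, f (j + 1) := by
  induction n with
  | zero => simp
  | succ n ih => rw [prod_Icc_succ_top (by omega), ih, prod_range_succ]

/-- A nonempty row `r` corresponds to the top row `j = lam.colLen (r + 1)` of the block of rows of
length `r + 1`, when that row loses no box; conversely `r = lam_j - 1`. -/
theorem rowsTail_transpose {lam mu : YoungDiagram}
    (hs : ∀ r, mu.rowLen r ≤ lam.rowLen r ∧ lam.rowLen r ≤ mu.rowLen r + 1) :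
    rowsTail lam.transpose mu.transpose =
      #{j ∈ range (lam.colLen 0) | mu.rowLen j = lam.rowLen j ∧
        (j = 0 ∨ lam.rowLen j < lam.rowLen (j - 1))} := by
  rw [rowsTail]
  simp only [YoungDiagram.colLen_transpose, YoungDiagram.rowLen_transpose]
  symm
  refine card_bij (fun j _ => lam.rowLen j - 1) ?_ ?_ ?_
  · intro j hj
    simp only [mem_filter, mem_range] at hj ⊢
    have h0 := lt_colLen_iff.1 hj.1
    have h1 := mu.rowLen_anti 0 j (Nat.zero_le j)
    refine ⟨by omega, ?_⟩
    have h2 : j < mu.colLen (lam.rowLen j - 1) := lt_colLen_iff.2 (by omega)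
    have h3 : ¬ j < lam.colLen (lam.rowLen j) := by rw [lt_colLen_iff]; exact lt_irrefl _
    rw [Nat.sub_add_cancel h0]
    omega
  · have key : ∀ j j', j < j' → lam.rowLen j = lam.rowLen j' →
        ¬ (j' = 0 ∨ lam.rowLen j' < lam.rowLen (j' - 1)) := by
      intro j j' hlt he h
      have := lam.rowLen_anti j (j' - 1) (by omega)
      omega
    intro j hj j' hj' he
    simp only [mem_filter, mem_range, lt_colLen_iff] at hj hj'
    have he' : lam.rowLen j = lam.rowLen j' := by omega
    rcases lt_trichotomy j j' with h | h | h
    · exact absurd hj'.2.2 (key _ _ h he')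
    · exact h
    · exact absurd hj.2.2 (key _ _ h he'.symm)
  · intro r hr
    simp only [mem_filter, mem_range] at hr
    have h1 : ¬ r + 1 < lam.rowLen (lam.colLen (r + 1)) := by
      rw [← lt_colLen_iff]; exact lt_irrefl _
    have h2 := lt_colLen_iff.1 hr.2
    have h3 := hs (lam.colLen (r + 1))
    refine ⟨lam.colLen (r + 1), ?_, by omega⟩
    simp only [mem_filter, mem_range, lt_colLen_iff]
    refine ⟨by omega, by omega, ?_⟩
    rcases Nat.eq_zero_or_pos (lam.colLen (r + 1)) with h0 | h0
    · exact Or.inl h0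
    · right
      have : lam.colLen (r + 1) - 1 < lam.colLen (r + 1) := by omega
      have := lt_colLen_iff.1 this
      omega

/-- The exponent of `1 / (1 + x)` counts rows that lose a box or are the top of a block of equal
rows. Row `j + 1` is such a row exactly when site `j` is nonempty or receives a particle. Shifting
the index by one is harmless because row `0` and the first empty row both count. -/
theorem rowsTail_transpose_add_card {lam mu : YoungDiagram}
    (hs : ∀ r, mu.rowLen r ≤ lam.rowLen r ∧ lam.rowLen r ≤ mu.rowLen r + 1) :
    rowsTail lam.transpose mu.transpose + (lam.card - mu.card) =
      #{j ∈ range (lam.colLen 0) | lam.rowLen (j + 1) < lam.rowLen j ∨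
        mu.rowLen (j + 1) < lam.rowLen (j + 1)} := by
  have hmu : mu ≤ lam := le_iff_rowLen.2 fun r => (hs r).1
  rw [rowsTail_transpose hs, card_sub_card le_rfl hmu]
  simp only [card_filter]
  rw [← sum_add_distrib]
  let f : ℕ → ℕ := fun j =>
    if j = 0 ∨ mu.rowLen j < lam.rowLen j ∨ lam.rowLen j < lam.rowLen (j - 1) then 1 else 0
  have h0 : f 0 = 1 := by simp [f]
  have hl : f (lam.colLen 0) = 1 := by
    have h1 : lam.rowLen (lam.colLen 0) = 0 := rowLen_eq_zero_iff.2 le_rfl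
    rcases Nat.eq_zero_or_pos (lam.colLen 0) with h | h
    · rw [h, h0]
    · have h2 : 0 < lam.rowLen (lam.colLen 0 - 1) := lt_colLen_iff.1 (by omega)
      simp only [f]
      rw [if_pos (by omega)]
  have h1 := sum_range_succ f (lam.colLen 0)
  rw [sum_range_succ', h0, hl] at h1
  calc _ = ∑ j ∈ range (lam.colLen 0), f j := by
        refine sum_congr rfl fun j _ => ?_
        have := hs j
        simp only [f]
        split_ifs <;> omega
    _ = ∑ j ∈ range (lam.colLen 0), f (j + 1) := by omega
    _ = _ := by
        refine sum_congr rfl fun j _ => ?_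
        simp only [f, Nat.add_sub_cancel]
        congr 1
        simp only [eq_iff_iff]
        omega

/-- Each factor of the formula belongs to one kind of site: `κ` to a departure without arrival, `E`
to a nonempty site with neither, powers of `x` to departures. The factor `1 / (1 + x)` occurs at
every site except an empty one with no arrival. -/
theorem oneJ_transpose_eq_vertexProd (q : K) {x : MvPowerSeries ℕ K}
    (hx : MvPowerSeries.constantCoeff x = 0) {Lam lam mu : YoungDiagram}
    (hlam : lam ≤ Lam) (hmu : mu ≤ Lam) :
    oneJ q lam.transpose mu.transpose x =
      vertexProd (algebraMap K _ q) x (1 + x)⁻¹ (Lam.colLen 0) lam mu := by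
  classical
  have hu : (1 + x)⁻¹ * (1 + x) = 1 := MvPowerSeries.inv_mul_cancel _ (by simp [hx])
  unfold oneJ
  split_ifs with h
  · have hs := isHorizontalStrip_transpose_iff.1 h
    have hle : mu ≤ lam := le_iff_rowLen.2 fun r => (hs r).1
    have hext : lam.colLen 0 ≤ Lam.colLen 0 := by
      rw [← rowLen_eq_zero_iff]; exact rowLen_eq_zero_of_le hlam le_rfl
    -- Sites beyond `lam` are empty and idle, of weight `(1 + x) / (1 + x) = 1`.
    rw [vertexProd, ← prod_subset (range_mono hext)]
    swap
    · intro r _ hr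
      rw [mem_range, not_lt, ← rowLen_eq_zero_iff] at hr
      have h1 := hs r
      have h2 := rowLen_succ_le lam r
      have h3 := rowLen_succ_le mu r
      rw [show mu.rowLen r = 0 by omega, hr, show lam.rowLen (r + 1) = 0 by omega,
        show mu.rowLen (r + 1) = 0 by omega]
      simp only [vertexWeight, sub_self, if_true, Nat.sub_self, pow_zero, mul_one]
      rw [mul_comm]; exact hu
    generalize hv : (1 + x)⁻¹ = u at hu ⊢
    have hpow : u ^ rowsTail lam.transpose mu.transpose *
        (x * u) ^ (lam.transpose.card - mu.transpose.card) =
        ∏ j ∈ range (lam.colLen 0), (x ^ (lam.rowLen j - mu.rowLen j) *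
          if lam.rowLen (j + 1) < lam.rowLen j ∨ mu.rowLen (j + 1) < lam.rowLen (j + 1)
            then u else 1) := by
      rw [card_transpose, card_transpose, prod_mul_distrib, ← prod_filter, prod_const,
        ← rowsTail_transpose_add_card hs, prod_pow_eq_pow_sum, ← card_sub_card le_rfl hle, mul_pow,
        pow_add]
      ring
    have hkappa : MvPowerSeries.C (kappa q lam.transpose mu.transpose) =
        ∏ j ∈ range (lam.colLen 0),
          if lam.rowLen j - lam.rowLen (j + 1) = mu.rowLen j - mu.rowLen (j + 1) + 1 then
            1 - algebraMap K (MvPowerSeries ℕ K) q ^ (lam.rowLen j - lam.rowLen (j + 1))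
          else 1 := by
      rw [kappa, YoungDiagram.rowLen_transpose, prod_filter, prod_Icc_one, map_prod]
      refine prod_congr rfl fun j _ => ?_
      simp only [mult_transpose]
      split_ifs
      · rw [map_sub, map_one, map_pow]; rfl
      · rw [map_one]
    have hE : ∏ i ∈ setE lam.transpose mu.transpose,
          (1 + x * MvPowerSeries.C (q ^ mult lam.transpose i)) =
        ∏ j ∈ range (lam.colLen 0),
          if lam.rowLen j = mu.rowLen j ∧ lam.rowLen (j + 1) = mu.rowLen (j + 1) ∧
            lam.rowLen j - lam.rowLen (j + 1) ≠ 0 then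
            1 + x * algebraMap K (MvPowerSeries ℕ K) q ^ (lam.rowLen j - lam.rowLen (j + 1))
          else 1 := by
      rw [setE, YoungDiagram.rowLen_transpose, prod_filter, prod_Icc_one]
      refine prod_congr rfl fun j _ => ?_
      simp only [mult_transpose, YoungDiagram.colLen_transpose, Nat.add_sub_cancel, map_pow]
      rfl
    rw [mul_assoc (MvPowerSeries.C _), hpow, hkappa, hE, ← prod_mul_distrib, ← prod_mul_distrib]
    refine prod_congr rfl fun j _ => ?_
    have h1 := hs j
    have h2 := hs (j + 1)
    have h3 := rowLen_succ_le mu j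
    have h4 := rowLen_succ_le lam j
    generalize algebraMap K (MvPowerSeries ℕ K) q = Q
    generalize lam.rowLen j = a at *
    generalize lam.rowLen (j + 1) = a' at *
    generalize mu.rowLen j = b at *
    generalize mu.rowLen (j + 1) = b' at *
    rcases (show a = b ∨ a = b + 1 by omega) with ho | ho <;>
    rcases (show a' = b' ∨ a' = b' + 1 by omega) with hi | hi
    · subst ho hi
      rcases h4.eq_or_lt with h5 | h5
      · subst h5
        simp only [vertexWeight, sub_self, if_true, Nat.sub_self, pow_zero, mul_one]
        simp
        linear_combination -hu
      · rw [if_neg (by omega), if_pos (by omega), if_pos (by omega)]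
        simp only [vertexWeight, sub_self, if_true, Nat.sub_self, pow_zero]
        ring
    · rw [if_neg (by omega), if_pos (by omega), if_neg (by omega)]
      subst ho hi
      simp [vertexWeight]
    · rw [if_pos (by omega), if_pos (by omega), if_neg (by omega)]
      subst ho hi
      simp [vertexWeight]
    · rw [if_neg (by omega), if_pos (by omega), if_neg (by omega)]
      subst ho hi
      simp [vertexWeight]
  · rw [isHorizontalStrip_transpose_iff] at h
    by_contra hne
    refine h fun r => ?_
    rcases lt_or_ge r (Lam.colLen 0) with hr | hr
    · exact vertexProd_ne_zero (Ne.symm hne) r hr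
    · simp [rowLen_eq_zero_of_le hlam hr, rowLen_eq_zero_of_le hmu hr]

end Translation

/-! ### One-variable series inside the ring of many variables -/

section OneVariable

variable {K : Type*} [Field K]

variable (K) in
/-- The substitution of the variable `X n` into power series in one variable. -/
def varHom (n : ℕ) : PowerSeries K →ₐ[K] MvPowerSeries ℕ K :=
  MvPowerSeries.rename (⟨fun _ => n, fun _ _ _ => rfl⟩ : Unit ↪ ℕ)

theorem varHom_X (n : ℕ) : varHom K n PowerSeries.X = MvPowerSeries.X n :=
  MvPowerSeries.rename_X _ _

theorem coeff_varHom_single (n k : ℕ) (f : PowerSeries K) :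
    MvPowerSeries.coeff (Finsupp.single n k) (varHom K n f) = PowerSeries.coeff k f := by
  have := MvPowerSeries.coeff_embDomain_rename (⟨fun _ => n, fun _ _ _ => rfl⟩ : Unit ↪ ℕ) f
    (Finsupp.single () k)
  rwa [Finsupp.embDomain_single] at this

theorem coeff_varHom_eq_zero (n : ℕ) (f : PowerSeries K) {m : ℕ →₀ ℕ} {i : ℕ} (hi : i ≠ n)
    (hm : m i ≠ 0) : MvPowerSeries.coeff m (varHom K n f) = 0 := by
  refine MvPowerSeries.coeff_rename_eq_zero _ _ ?_
  rintro ⟨d, rfl⟩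
  refine hm (Finsupp.mapDomain_of_notMem_range _ _ ?_)
  rintro ⟨_, h⟩
  exact hi h.symm

/-- The coefficients of `g * f (X n)` if `g` does not involve `X n`. -/
theorem coeff_mul_varHom (n : ℕ) (f : PowerSeries K) (g : MvPowerSeries ℕ K)
    (hg : ∀ m : ℕ →₀ ℕ, m n ≠ 0 → MvPowerSeries.coeff m g = 0) (m : ℕ →₀ ℕ) :
    MvPowerSeries.coeff m (g * varHom K n f) =
      MvPowerSeries.coeff (m.erase n) g * PowerSeries.coeff (m n) f := by
  classical
  rw [MvPowerSeries.coeff_mul, sum_eq_single (m.erase n, Finsupp.single n (m n))]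
  · simp only [coeff_varHom_single]
  · rintro ⟨a, b⟩ hab hne
    rw [HasAntidiagonal.mem_antidiagonal] at hab
    by_contra h
    apply hne
    have ha : a n = 0 := by
      by_contra h0
      exact left_ne_zero_of_mul h (hg a h0)
    have hb : ∀ i, i ≠ n → b i = 0 := by
      intro i hi
      by_contra h0
      exact right_ne_zero_of_mul h (coeff_varHom_eq_zero n f hi h0)
    have hb' : b = Finsupp.single n (m n) := by
      ext i
      by_cases hi : i = n
      · subst hi
        rw [← hab]; simp [ha]
      · rw [hb i hi, Finsupp.single_eq_of_ne hi]
    have ha' : a = m.erase n := by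
      ext i
      by_cases hi : i = n
      · subst hi; simp [ha]
      · rw [Finsupp.erase_ne hi, ← hab, Finsupp.add_apply, hb i hi, add_zero]
    rw [ha', hb']
  · intro h
    exact absurd (by rw [HasAntidiagonal.mem_antidiagonal, Finsupp.erase_add_single]) h

end OneVariable

/-! ### The branching rule as a matrix product -/

section Branching

variable {K : Type*} [Field K]

theorem branch_eq_zero {f : YoungDiagram → YoungDiagram → MvPowerSeries ℕ K → MvPowerSeries ℕ K}
    {lam mu : YoungDiagram} (h : ¬ mu ≤ lam) (n : ℕ) : branch f mu n lam = 0 := by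
  cases n with
  | zero => rw [branch, if_neg]; rintro rfl; exact h le_rfl
  | succ n =>
    rw [branch]
    refine sum_eq_zero fun nu hnu => ?_
    simp only [between, Set.Finite.mem_toFinset] at hnu
    exact absurd (hnu.1.trans hnu.2.1) h

/-- Extending the sum to all partitions inside `Lam` adds only zero terms, so one branching step is
multiplication by a finite matrix. -/
theorem branch_succ {f : YoungDiagram → YoungDiagram → MvPowerSeries ℕ K → MvPowerSeries ℕ K}
    (hf : ∀ lam nu x, ¬ IsHorizontalStrip nu lam → f lam nu x = 0)
    {Lam : YoungDiagram} (lam mu : {nu : YoungDiagram // nu ≤ Lam}) (n : ℕ) :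
    branch f mu (n + 1) lam = ∑ nu : {nu : YoungDiagram // nu ≤ Lam},
      branch f mu n nu * f lam nu (MvPowerSeries.X n) := by
  rw [branch]
  symm
  refine sum_bij_ne_zero (fun nu _ _ => nu.1) ?_ (fun _ _ _ _ _ _ h => Subtype.ext h) ?_
    (fun _ _ _ => rfl)
  · intro nu _ hne
    simp only [between, Set.Finite.mem_toFinset]
    refine ⟨?_, ?_⟩
    · by_contra h
      exact left_ne_zero_of_mul hne (branch_eq_zero h n)
    · by_contra h
      exact right_ne_zero_of_mul hne (hf _ _ _ h)
  · intro nu hnu hne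
    simp only [between, Set.Finite.mem_toFinset] at hnu
    exact ⟨⟨nu, hnu.2.1.trans lam.2⟩, mem_univ _, hne, rfl⟩

variable {B I : Type*} [CommRing B] [Algebra K B] [Fintype I] [DecidableEq I]

/-- If the one-variable functions are the entries of a power series `T` over a commutative algebra
of matrices, then the function in countably many variables is an entry of `∏ i, T (X i)`. -/
theorem branchLimit_eq_prodSeries
    {f : YoungDiagram → YoungDiagram → MvPowerSeries ℕ K → MvPowerSeries ℕ K}
    (hf : ∀ lam nu x, ¬ IsHorizontalStrip nu lam → f lam nu x = 0)
    {Lam : YoungDiagram} (t : I ≃ {nu : YoungDiagram // nu ≤ Lam})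
    (S : I → I → PowerSeries K)
    (hS : ∀ i j n, f (t i) (t j) (MvPowerSeries.X n) = varHom K n (S i j))
    (rho : B →ₐ[K] Matrix I I K) (T : PowerSeries B) (hT0 : PowerSeries.constantCoeff T = 1)
    (hT : ∀ k i j, rho (PowerSeries.coeff k T) i j = PowerSeries.coeff k (S i j)) (i j : I) :
    branchLimit f (t i) (t j) =
      prodSeries ((Matrix.entryLinearMap K K i j).comp rho.toLinearMap) T := by
  classical
  have hT0' : PowerSeries.coeff 0 T = 1 := by simpa using hT0
  -- The branching rule multiplies by the newest variable on the left; commutativity of `B` lets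
  -- that factor be moved to the end of the product.
  have main : ∀ n i (m : ℕ →₀ ℕ), MvPowerSeries.coeff m (branch f (t j) n (t i)) =
      if ∀ v ∈ m.support, v < n then
        rho (∏ v ∈ range n, PowerSeries.coeff (m v) T) i j else 0 := by
    intro n
    induction n with
    | zero =>
      intro i m
      have hm : (∀ v ∈ m.support, v < 0) ↔ m = 0 := by
        simp [← Finsupp.support_eq_empty, eq_empty_iff_forall_notMem]
      simp only [hm, branch, range_zero, prod_empty, map_one, Matrix.one_apply, Subtype.ext_iff.symm,
        t.injective.eq_iff]
      split_ifs with h1 h2 h2 <;> simp [MvPowerSeries.coeff_one, h2]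
    | succ n ih =>
      intro i m
      have hvar : ∀ k (m : ℕ →₀ ℕ), m n ≠ 0 →
          MvPowerSeries.coeff m (branch f (t j) n (t k)) = 0 := by
        intro k m hm
        rw [ih, if_neg]
        intro h
        exact lt_irrefl _ (h n (Finsupp.mem_support_iff.2 hm))
      have hsupp : (∀ v ∈ (m.erase n).support, v < n) ↔ ∀ v ∈ m.support, v < n + 1 := by
        simp only [Finsupp.support_erase, mem_erase]
        refine ⟨fun h v hv => ?_, fun h v hv => ?_⟩
        · by_cases hvn : v = n
          · omega
          · have := h v ⟨hvn, hv⟩; omega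
        · have := h v hv.2; have := hv.1; omega
      rw [branch_succ hf, ← t.sum_comp, map_sum]
      simp only [hS, fun k => coeff_mul_varHom n (S i k) _ (hvar k) m, ih, hsupp]
      split_ifs with h
      · have e : ∏ v ∈ range n, PowerSeries.coeff (m.erase n v) T =
            ∏ v ∈ range n, PowerSeries.coeff (m v) T :=
          prod_congr rfl fun v hv => by rw [Finsupp.erase_ne (mem_range.1 hv).ne]
        rw [prod_range_succ, mul_comm, map_mul, Matrix.mul_apply, e]
        refine sum_congr rfl fun k _ => ?_
        rw [hT, mul_comm]
      · simp
  ext m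
  change MvPowerSeries.coeff m (branch f (t j) (m.support.sup (· + 1)) (t i)) = _
  have hlt : ∀ v ∈ m.support, v < m.support.sup (· + 1) := fun v hv =>
    Finset.le_sup (f := (· + 1)) hv
  rw [main, if_pos hlt, coeff_prodSeries, Finsupp.prod_of_support_subset m
    (fun v hv => mem_range.2 (hlt v hv)) _ (by simp [hT0'])]
  rfl

end Branching

/-! ### Compatibility of the weights with algebra homomorphisms -/

section Naturality

variable {K A A' : Type*} [Field K] [CommRing A] [Algebra K A] [CommRing A'] [Algebra K A']

theorem map_hopWeight (h : A →ₐ[K] A') (q : K) (x : A) (m k : ℕ) :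
    h (hopWeight q x m k) = hopWeight q (h x) m k := by
  unfold hopWeight qPoch
  split_ifs <;> simp

theorem map_hopProd (h : A →ₐ[K] A') (q : K) (x : A) (l : ℕ) (lam mu : YoungDiagram) :
    h (hopProd q x l lam mu) = hopProd q (h x) l lam mu := by
  unfold hopProd
  rw [map_prod]
  refine prod_congr rfl fun r _ => ?_
  split_ifs
  · exact map_hopWeight h q x _ _
  · exact map_zero h

theorem map_vertexProd (h : A →ₐ[K] A') (Q x u : A) (l : ℕ) (lam mu : YoungDiagram) :
    h (vertexProd Q x u l lam mu) = vertexProd (h Q) (h x) (h u) l lam mu := by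
  unfold vertexProd vertexWeight
  rw [map_prod]
  refine prod_congr rfl fun r _ => ?_
  split_ifs <;> simp

end Naturality

/-! ### Coefficient matrices and the commutative algebra they generate -/

section Series

variable {K : Type*} [Field K]

/-- The entries of the `q`-Whittaker transfer matrix on the partitions contained in `Lam`. -/
def hopSeries (q : K) (Lam : YoungDiagram) (lam mu : {nu : YoungDiagram // nu ≤ Lam}) :
    PowerSeries K :=
  hopProd q PowerSeries.X (Lam.colLen 0) lam mu

/-- The entries of the Hall–Littlewood transfer matrix on the partitions contained in `Lam`. -/
def vertexSeries (q : K) (Lam : YoungDiagram) (lam mu : {nu : YoungDiagram // nu ≤ Lam}) :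
    PowerSeries K :=
  vertexProd (algebraMap K _ q) PowerSeries.X (1 + PowerSeries.X)⁻¹ (Lam.colLen 0) lam mu

theorem oneF_X (q : K) (Lam : YoungDiagram) (lam mu : {nu : YoungDiagram // nu ≤ Lam}) (n : ℕ) :
    oneF q lam mu (MvPowerSeries.X n) = varHom K n (hopSeries q Lam lam mu) := by
  rw [hopSeries, map_hopProd, varHom_X, oneF_eq_hopProd q _ lam.2 mu.2]

theorem varHom_inv (n : ℕ) : varHom K n (1 + PowerSeries.X)⁻¹ = (1 + MvPowerSeries.X n)⁻¹ := by
  rw [MvPowerSeries.eq_inv_iff_mul_eq_one (by simp), ← varHom_X, ← map_one (varHom K n), ← map_add,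
    ← map_mul, PowerSeries.inv_mul_cancel _ (by simp)]

theorem oneJ_X (q : K) (Lam : YoungDiagram) (lam mu : {nu : YoungDiagram // nu ≤ Lam}) (n : ℕ) :
    oneJ q lam.1.transpose mu.1.transpose (MvPowerSeries.X n) =
      varHom K n (vertexSeries q Lam lam mu) := by
  rw [vertexSeries, map_vertexProd, varHom_X, varHom_inv, AlgHom.commutes,
    oneJ_transpose_eq_vertexProd q (by simp) lam.2 mu.2]

/-- The coefficients of the `q`-Whittaker transfer matrix. -/
def hopMatrix (q : K) (Lam : YoungDiagram) (k : ℕ) :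
    Matrix {nu : YoungDiagram // nu ≤ Lam} {nu : YoungDiagram // nu ≤ Lam} K :=
  Matrix.of fun lam mu => PowerSeries.coeff k (hopSeries q Lam lam mu)

/-- The coefficients of the Hall–Littlewood transfer matrix. -/
def vertexMatrix (q : K) (Lam : YoungDiagram) (k : ℕ) :
    Matrix {nu : YoungDiagram // nu ≤ Lam} {nu : YoungDiagram // nu ≤ Lam} K :=
  Matrix.of fun lam mu => PowerSeries.coeff k (vertexSeries q Lam lam mu)

theorem coeff_varHom_mul_varHom (f g : PowerSeries K) (a b : ℕ) :
    MvPowerSeries.coeff (Finsupp.single 0 a + Finsupp.single 1 b) (varHom K 0 f * varHom K 1 g) =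
      PowerSeries.coeff a f * PowerSeries.coeff b g := by
  rw [coeff_mul_varHom 1 g _ fun m hm => coeff_varHom_eq_zero 0 f one_ne_zero hm]
  have h1 : (Finsupp.single 0 a + Finsupp.single 1 b : ℕ →₀ ℕ).erase 1 = Finsupp.single 0 a := by
    rw [Finsupp.erase_add, Finsupp.erase_single, add_zero,
      Finsupp.erase_of_notMem_support]
    simp
  rw [h1, coeff_varHom_single]
  simp

/-- The exchange relation is applied with two independent variables as parameters, and the
coefficient of `X_0^a X_1^b` is read off. -/
theorem vertexMatrix_comm (q : K) (Lam : YoungDiagram) (a b : ℕ) :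
    vertexMatrix q Lam a * vertexMatrix q Lam b = vertexMatrix q Lam b * vertexMatrix q Lam a := by
  classical
  have : IsDomain (MvPowerSeries ℕ K) := NoZeroDivisors.to_isDomain _
  ext lam mu
  have hxy : (MvPowerSeries.X 1 - algebraMap K (MvPowerSeries ℕ K) q * MvPowerSeries.X 0 :
      MvPowerSeries ℕ K) ≠ 0 := by
    intro h
    have := congrArg (MvPowerSeries.coeff (Finsupp.single 1 1)) h
    rw [map_sub, ← Algebra.smul_def, MvPowerSeries.coeff_smul, MvPowerSeries.coeff_X,
      MvPowerSeries.coeff_X] at this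
    simp [Finsupp.single_eq_single_iff] at this
  have h := sum_vertexProd_mul_vertexProd (u := (1 + MvPowerSeries.X 1)⁻¹)
    (v := (1 + MvPowerSeries.X 0)⁻¹) hxy lam.2 mu.2
  have e : ∀ n (lam mu : {nu : YoungDiagram // nu ≤ Lam}),
      vertexProd (algebraMap K (MvPowerSeries ℕ K) q) (MvPowerSeries.X n)
        (1 + MvPowerSeries.X n)⁻¹ (Lam.colLen 0) lam mu =
      varHom K n (vertexSeries q Lam lam mu) := fun n lam mu => by
    rw [← oneJ_X, oneJ_transpose_eq_vertexProd q (by simp) lam.2 mu.2]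
  simp only [e] at h
  have h' := congrArg (MvPowerSeries.coeff (Finsupp.single 0 a + Finsupp.single 1 b)) h
  simp only [mul_comm (varHom K 1 _), map_sum, coeff_varHom_mul_varHom] at h'
  rw [Matrix.mul_apply, Matrix.mul_apply]
  simp only [vertexMatrix, Matrix.of_apply]
  rw [← h']
  exact sum_congr rfl fun nu _ => mul_comm _ _

theorem rescale_hopSeries (q c : K) (Lam : YoungDiagram)
    (lam mu : {nu : YoungDiagram // nu ≤ Lam}) :
    PowerSeries.rescale c (hopSeries q Lam lam mu) =
      hopProd q (algebraMap K _ c * PowerSeries.X : PowerSeries K) (Lam.colLen 0) lam mu := by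
  rw [hopSeries, ← PowerSeries.coe_rescaleAlgHom]
  simp only [RingHom.coe_coe]
  rw [map_hopProd, ← RingHom.coe_coe, PowerSeries.coe_rescaleAlgHom, PowerSeries.rescale_X]
  rfl

theorem sum_vertexMatrix_mul_hopMatrix {q : K} (hq : ∀ n : ℕ, 1 ≤ n → q ^ n ≠ 1)
    (Lam : YoungDiagram) (n : ℕ) :
    ∑ p ∈ antidiagonal n, vertexMatrix q Lam p.1 * ((-1 : K) ^ p.2 • hopMatrix q Lam p.2) =
      (-q) ^ n • hopMatrix q Lam n := by
  ext lam mu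
  have h := sum_vertexProd_mul_hopProd (mu := mu.1) hq
    (PowerSeries.inv_mul_cancel (1 + PowerSeries.X : PowerSeries K) (by simp)) lam.2
  have e1 : (-PowerSeries.X : PowerSeries K) = algebraMap K _ (-1) * PowerSeries.X := by simp
  have e2 : (-(algebraMap K (PowerSeries K) q * PowerSeries.X) : PowerSeries K) =
    algebraMap K _ (-q) * PowerSeries.X := by rw [map_neg, neg_mul]
  rw [e1, e2, ← rescale_hopSeries] at h
  have h' := congrArg (PowerSeries.coeff n) h
  rw [map_sum, PowerSeries.coeff_rescale] at h'
  rw [Matrix.sum_apply, Matrix.smul_apply, smul_eq_mul, hopMatrix, Matrix.of_apply, ← h']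
  simp only [Matrix.mul_apply]
  rw [sum_comm]
  refine sum_congr rfl fun nu _ => ?_
  rw [← rescale_hopSeries q (-1) Lam nu mu, PowerSeries.coeff_mul]
  refine sum_congr rfl fun p _ => ?_
  rw [PowerSeries.coeff_rescale]
  rfl

/-- Turns the delta property at `x = 0` into the statement that the constant coefficient matrix is
the identity. -/
theorem coeff_zero_of_dvd {f : YoungDiagram → YoungDiagram → MvPowerSeries ℕ K → MvPowerSeries ℕ K}
    (hf : IsDeltaAtZero f) {lam mu : YoungDiagram} [Decidable (lam = mu)] {S : PowerSeries K}
    (hS : f lam mu (MvPowerSeries.X 0) = varHom K 0 S) :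
    PowerSeries.coeff 0 S = if lam = mu then 1 else 0 := by
  have h := hf lam mu (MvPowerSeries.X 0)
  rw [hS] at h
  have h0 := MvPowerSeries.X_dvd_iff.1 h 0 rfl
  rw [map_sub, sub_eq_zero, ← Finsupp.single_zero (0 : ℕ), coeff_varHom_single] at h0
  rw [h0, Finsupp.single_zero]
  split_ifs <;> simp

open Classical in
theorem hopMatrix_zero {q : K} (hq : ∀ n : ℕ, 1 ≤ n → q ^ n ≠ 1) (Lam : YoungDiagram) :
    hopMatrix q Lam 0 = 1 := by
  ext lam mu
  rw [hopMatrix, Matrix.of_apply, coeff_zero_of_dvd (isDeltaAtZero_oneF hq) (oneF_X q Lam lam mu 0),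
    Matrix.one_apply]
  simp only [Subtype.ext_iff]

open Classical in
theorem vertexMatrix_zero (q : K) (Lam : YoungDiagram) : vertexMatrix q Lam 0 = 1 := by
  ext lam mu
  rw [vertexMatrix, Matrix.of_apply, coeff_zero_of_dvd (isDeltaAtZero_oneJ q)
    (oneJ_X q Lam lam mu 0), Matrix.one_apply]
  simp only [Subtype.ext_iff, YoungDiagram.transpose_eq_iff]

-- In degree `n` of `V(x) H(-x) = H(-qx)` the term with `V_0 = 1` is `(-1)^n H_n`. Moving it across
-- leaves `((-q)^n - (-1)^n) H_n`, whose factor is invertible as `q^n ≠ 1`, in terms of `V_a H_b`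
-- with `b < n`.
open Classical in
theorem hopMatrix_mem_adjoin {q : K} (hq : ∀ n : ℕ, 1 ≤ n → q ^ n ≠ 1) (Lam : YoungDiagram)
    (n : ℕ) : hopMatrix q Lam n ∈ Algebra.adjoin K (Set.range (vertexMatrix q Lam)) := by
  induction n using Nat.strong_induction_on with
  | _ n ih =>
  rcases Nat.eq_zero_or_pos n with rfl | hn
  · rw [hopMatrix_zero hq]; exact one_mem _
  have h := sum_vertexMatrix_mul_hopMatrix hq Lam n
  have hmem : ((0, n) : ℕ × ℕ) ∈ antidiagonal n := by simp
  rw [← add_sum_erase _ _ hmem, vertexMatrix_zero, one_mul] at h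
  have hc : (-q) ^ n - (-1) ^ n ≠ 0 := by
    rw [neg_pow q, ← mul_sub_one]
    exact mul_ne_zero (pow_ne_zero _ (by simp)) (sub_ne_zero.2 (hq n hn))
  have h2 : hopMatrix q Lam n = ((-q) ^ n - (-1) ^ n)⁻¹ •
      ∑ p ∈ (antidiagonal n).erase (0, n),
        vertexMatrix q Lam p.1 * ((-1 : K) ^ p.2 • hopMatrix q Lam p.2) := by
    rw [eq_inv_smul_iff₀ hc, sub_smul, ← h, add_sub_cancel_left]
  rw [h2]
  refine Subalgebra.smul_mem _ (Subalgebra.sum_mem _ fun p hp => ?_) _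
  rw [mem_erase, HasAntidiagonal.mem_antidiagonal] at hp
  have hlt : p.2 < n := by
    by_contra hge
    exact hp.1 (Prod.ext (by simp only; omega) (by simp only; omega))
  exact Subalgebra.mul_mem _ (Algebra.subset_adjoin ⟨p.1, rfl⟩)
    (Subalgebra.smul_mem _ (ih p.2 hlt) _)

end Series

end
end InhomWhittaker

/-! ### The theorem -/

open InhomWhittaker Finset in
open scoped IsMulCommutative in
theorem proposition2p12 {K : Type*} [Field K] [CharZero K] (q : K)
    (hq : ∀ n : ℕ, 1 ≤ n → q ^ n ≠ 1) (lam mu : YoungDiagram) :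
    ∃ (hF : InhomWhittaker.skewF q lam mu ∈ InhomWhittaker.SymSeries K)
      (hJ : InhomWhittaker.skewJ q lam.transpose mu.transpose ∈ InhomWhittaker.SymSeries K),
      InhomWhittaker.omega q 0 ⟨InhomWhittaker.skewF q lam mu, hF⟩ =
        ⟨InhomWhittaker.skewJ q lam.transpose mu.transpose, hJ⟩ := by
  classical
  -- The join makes both partitions matrix indices even if `mu ⊆ lam` fails.
  set Lam := lam ⊔ mu
  let B := Algebra.adjoin K (Set.range (vertexMatrix q Lam))
  have hcomm : IsMulCommutative B := Algebra.isMulCommutative_adjoin K (by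
    rintro _ ⟨a, rfl⟩ _ ⟨b, rfl⟩
    exact vertexMatrix_comm q Lam a b)
  let i : {nu : YoungDiagram // nu ≤ Lam} := ⟨lam, le_sup_left⟩
  let j : {nu : YoungDiagram // nu ≤ Lam} := ⟨mu, le_sup_right⟩
  let T : PowerSeries B := PowerSeries.mk fun n => ⟨hopMatrix q Lam n, hopMatrix_mem_adjoin hq Lam n⟩
  let J : PowerSeries B := PowerSeries.mk fun n => ⟨vertexMatrix q Lam n,
    Algebra.subset_adjoin ⟨n, rfl⟩⟩
  have hT : PowerSeries.constantCoeff T = 1 := by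
    rw [← PowerSeries.coeff_zero_eq_constantCoeff_apply, PowerSeries.coeff_mk]
    exact Subtype.ext (hopMatrix_zero hq Lam)
  have hJ : PowerSeries.constantCoeff J = 1 := by
    rw [← PowerSeries.coeff_zero_eq_constantCoeff_apply, PowerSeries.coeff_mk]
    exact Subtype.ext (vertexMatrix_zero q Lam)
  have hJT : J * PowerSeries.rescale (-1) T = PowerSeries.rescale (-algebraMap K B q) T := by
    ext n : 1
    rw [PowerSeries.coeff_mul, PowerSeries.coeff_rescale]
    apply Subtype.ext
    have h := sum_vertexMatrix_mul_hopMatrix hq Lam n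
    have e1 : ∀ k, (((-1 : B) ^ k * PowerSeries.coeff k T : B) : Matrix _ _ K) =
        (-1 : K) ^ k • hopMatrix q Lam k := by
      intro k
      rw [← map_one (algebraMap K B), ← map_neg, ← map_pow, ← Algebra.smul_def]
      simp only [T, PowerSeries.coeff_mk]
      rfl
    have e2 : (((-algebraMap K B q) ^ n * PowerSeries.coeff n T : B) : Matrix _ _ K) =
        (-q) ^ n • hopMatrix q Lam n := by
      rw [← map_neg, ← map_pow, ← Algebra.smul_def]
      simp only [T, PowerSeries.coeff_mk]
      rfl
    rw [e2, ← h, AddSubmonoidClass.coe_finsetSum]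
    refine sum_congr rfl fun p _ => ?_
    rw [PowerSeries.coeff_rescale, ← e1]
    simp only [J, PowerSeries.coeff_mk]
    rfl
  have hF := branchLimit_eq_prodSeries (f := oneF q) (fun _ _ _ h => if_neg h) (Equiv.refl _)
    (hopSeries q Lam) (fun i j n => oneF_X q Lam i j n) B.val T hT
    (fun k i j => by simp only [T, PowerSeries.coeff_mk]; rfl) i j
  -- The matrices `V_k` are indexed by partitions inside `Lam`, but `J` is evaluated at their
  -- conjugates; `t` relabels the indices.
  let t : {nu : YoungDiagram // nu ≤ Lam} ≃ {nu : YoungDiagram // nu ≤ Lam.transpose} :=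
    YoungDiagram.transposeOrderIso.toEquiv.subtypeEquiv fun nu =>
      (YoungDiagram.transpose_le_iff).symm
  have hJ' := branchLimit_eq_prodSeries (f := oneJ q) (fun _ _ _ h => if_neg h) t
    (vertexSeries q Lam) (fun i j n => oneJ_X q Lam i j n) B.val J hJ
    (fun k i j => by simp only [J, PowerSeries.coeff_mk]; rfl) i j
  obtain ⟨h1, h2, h3⟩ := omega_prodSeries q ((Matrix.entryLinearMap K K i j).comp B.val.toLinearMap)
    T J hT hJT
  have eF : skewF q lam mu = _ := hF
  have eJ : skewJ q lam.transpose mu.transpose = _ := hJ'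
  refine ⟨eF ▸ h1, eJ ▸ h2, ?_⟩
  convert h3
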